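/- Let $k\ge 2$. For a digit $a\in\{0,1,\dots,k-1\}$ put $\overline{a}=k-1-a$. A positive integer with canonical base-$k$ representation $d_1d_2\cdots d_\ell$ (where $d_1\neq 0$) is called antipalindromic in base $k$ if $d_{\ell+1-i}=\overline{d_i}$ for all $1\le i\le \ell$. (In particular, if $\ell$ is odd, the middle digit must equal $(k-1)/2$, so $k$ must be odd.) There is an algorithm that, given integers $k\ge 2$ and $N\ge 0$, determines whether there exist base-$k$ antipalindromic numbers $A$ and $B$ with $N=A/B$, and that runs in $O(k^2N^3)$ time (in constant time if $N=0$). The implied constant is absolute, that is, independent of both $k$ and $N$. Time is counted as the number of steps of a single fixed program on a unit-cost random access machine with addition, truncated subtraction, multiplication, integer division, remainder, indirect addressing and conditional jumps, all of whose registers contain at every moment numbers bounded by a fixed polynomial in $k+N$ (that is, words of $O(\log(k+N))$ bits). -/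

import Mathlib

/-- A natural number is antipalindromic in base `k` if it is positive and its canonical base-`k`
representation is equal to its own reverse complement, where the complement of a digit `a` is
`k - 1 - a`.  (`Nat.digits` lists the digits from the least significant one; the condition does
not depend on the direction of reading.  The middle digit `s` of a representation of odd length
has to satisfy `s = k - 1 - s`.) -/
def IsAntipalindromic (k n : ℕ) : Prop :=
  0 < n ∧ (Nat.digits k n).reverse = (Nat.digits k n).map (fun a => k - 1 - a)

/-- `N` is a quotient `A / B` of two base-`k` antipalindromic numbers. -/
def IsAntipalindromicQuotient (k N : ℕ) : Prop :=
  ∃ A B : ℕ, IsAntipalindromic k A ∧ IsAntipalindromic k B ∧ (N : ℚ) = (A : ℚ) / (B : ℚ)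

namespace RAM

/-- The instructions of a random access machine.  The memory cells ("registers") are indexed by
natural numbers and hold natural numbers.  Arguments `d a b` are addresses of registers. -/
inductive Instr where
  /-- `r[d] := v` -/
  | const (d v : ℕ)
  /-- `r[d] := r[a]` -/
  | copy (d a : ℕ)
  /-- `r[d] := r[a] + r[b]` -/
  | add (d a b : ℕ)
  /-- `r[d] := max (r[a] - r[b]) 0` -/
  | sub (d a b : ℕ)
  /-- `r[d] := r[a] * r[b]` -/
  | mul (d a b : ℕ)
  /-- `r[d] := ⌊r[a] / r[b]⌋`, which is `0` if `r[b] = 0` -/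
  | div (d a b : ℕ)
  /-- `r[d] := r[a] mod r[b]`, which is `r[a]` if `r[b] = 0` -/
  | mod (d a b : ℕ)
  /-- indirect read: `r[d] := r[r[a]]` -/
  | load (d a : ℕ)
  /-- indirect write: `r[r[d]] := r[a]` -/
  | store (d a : ℕ)
  /-- continue at the instruction with number `l` -/
  | jump (l : ℕ)
  /-- continue at the instruction with number `l` if `r[a] = 0` -/
  | jumpZero (a l : ℕ)

/-- A program is a finite list of instructions, numbered from `0`. -/
abbrev Program := List Instr

/-- A configuration: the number of the next instruction and the contents of the memory. -/
@[ext]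
structure Config where
  pc : ℕ
  mem : ℕ → ℕ

/-- Write `v` to the cell with address `d` and go on to the next instruction. -/
def Config.write (c : Config) (d v : ℕ) : Config :=
  ⟨c.pc + 1, Function.update c.mem d v⟩

/-- The effect of a single instruction. -/
def Instr.exec (c : Config) : Instr → Config
  | .const d v => c.write d v
  | .copy d a => c.write d (c.mem a)
  | .add d a b => c.write d (c.mem a + c.mem b)
  | .sub d a b => c.write d (c.mem a - c.mem b)
  | .mul d a b => c.write d (c.mem a * c.mem b)
  | .div d a b => c.write d (c.mem a / c.mem b)
  | .mod d a b => c.write d (c.mem a % c.mem b)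
  | .load d a => c.write d (c.mem (c.mem a))
  | .store d a => c.write (c.mem d) (c.mem a)
  | .jump l => ⟨l, c.mem⟩
  | .jumpZero a l => ⟨if c.mem a = 0 then l else c.pc + 1, c.mem⟩

/-- The machine halts when there is no instruction with the current number. -/
def Halted (P : Program) (c : Config) : Prop := P.length ≤ c.pc

/-- One step of the machine; a halted machine does not change any more. -/
def step (P : Program) (c : Config) : Config :=
  match P[c.pc]? with
  | some i => i.exec c
  | none => c

/-- The initial configuration on input `(x, y)`: the input is in the registers `0` and `1`, and
all the other registers are `0`. -/
def start (x y : ℕ) : Config :=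
  ⟨0, fun r => if r = 0 then x else if r = 1 then y else 0⟩

/-- The configuration after `t` steps of the program `P` on input `(x, y)`. -/
def run (P : Program) (x y t : ℕ) : Config := (step P)^[t] (start x y)

/-- On input `(x, y)` the program halts after at most `T` steps, with the answer to the question
whether `Q` holds in register `0` (`1` for yes and `0` for no). -/
def DecidesWithin (P : Program) (x y : ℕ) (Q : Prop) (T : ℕ) : Prop :=
  ∃ t ≤ T, Halted P (run P x y t) ∧
    (Q → (run P x y t).mem 0 = 1) ∧ (¬ Q → (run P x y t).mem 0 = 0)

/-- Throughout the run on input `(x, y)` no register (and hence no address computed by the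
program) exceeds `W`. -/
def WordsBoundedBy (P : Program) (x y W : ℕ) : Prop :=
  ∀ t r, (run P x y t).mem r ≤ W

end RAM

/-! Suppose N * B = A, where B has n digits and A has n + s. Since A ≥ B and A < N * k ^ n, only
length differences with k ^ s < k * N occur (`isAntipalindromicQuotient_iff`), so there are O(log N)
of them and each is treated separately.

For fixed s, the product is computed from both ends at once. The lowest digit b of B fixes its
highest digit k - 1 - b; with the incoming carry it also fixes the lowest digit of A, hence the
highest one. After these outer digits are removed, all that has to be remembered is the carry c and
the discrepancy E - N at the upper end (`Fits`, `fits_step`). The shift by N keeps E natural. As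
inner strings of n and n + s digits are below k ^ n and k ^ (n + s), size alone forces c < N and 0 <
E < N + k ^ s (`nextCarry_lt`, `Fits.bounds`). So solutions are paths in a graph with at most N * (N
+ k ^ s) vertices and at most k edges at each, ending where at most one digit of B is left
(`fits_zero`, `fits_one`). A breadth first search decides whether such a path exists
(`SearchState.Inv`, `Inv.not_fits`).

Each edge costs O(s + 1) steps, so one search costs O(k ^ 2 * N ^ 2 * (log N + 2)). Over all s this
gives O(k ^ 2 * N ^ 2 * (log N + 2) ^ 2), and the squared logarithm is O(N) (`rounds_le`). Time and
word size are carried through the machine program by a total-correctness calculus (`Term`), whose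
conclusions transfer to compiled code by `Term.decidesWithin`. -/

namespace RAM

/-! ### Structured programs and proof rules with time and word bounds -/

/-- The contents of the memory. -/
abbrev Mem := ℕ → ℕ

/-- The address and the value that an instruction writes; a jump writes nothing. -/
def Instr.effect (m : Mem) : Instr → Option (ℕ × ℕ)
  | .const d v => some (d, v)
  | .copy d a => some (d, m a)
  | .add d a b => some (d, m a + m b)
  | .sub d a b => some (d, m a - m b)
  | .mul d a b => some (d, m a * m b)
  | .div d a b => some (d, m a / m b)
  | .mod d a b => some (d, m a % m b)
  | .load d a => some (d, m (m a))
  | .store d a => some (m d, m a)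
  | .jump _ => none
  | .jumpZero _ _ => none

theorem Instr.exec_of_effect {i : Instr} {p : ℕ} {m : Mem} {d v : ℕ}
    (h : i.effect m = some (d, v)) : i.exec ⟨p, m⟩ = ⟨p + 1, Function.update m d v⟩ := by
  cases i <;> simp_all [Instr.effect, Instr.exec, Config.write]

/-- Structured programs. -/
inductive Cmd where
  /-- a list of instructions without jumps -/
  | block (l : List Instr)
  /-- sequential composition -/
  | seq (c d : Cmd)
  /-- run `c` if `r[a] = 0`, and `d` otherwise -/
  | ifZero (a : ℕ) (c d : Cmd)
  /-- run `c` as long as `r[a] ≠ 0` -/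
  | loop (a : ℕ) (c : Cmd)

/-- The number of instructions of the compiled program. -/
def Cmd.length : Cmd → ℕ
  | .block l => l.length
  | .seq c d => c.length + d.length
  | .ifZero _ c d => d.length + 2 + c.length
  | .loop _ c => c.length + 2

/-- The compiled program, to be placed at position `p`. -/
def Cmd.compile : Cmd → ℕ → List Instr
  | .block l, _ => l
  | .seq c d, p => c.compile p ++ d.compile (p + c.length)
  | .ifZero a c d, p => [.jumpZero a (p + (d.length + 2))] ++ (d.compile (p + 1) ++
      ([.jump (p + (d.length + 2 + c.length))] ++ c.compile (p + (d.length + 2))))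
  | .loop a c, p => [.jumpZero a (p + (c.length + 2))] ++ (c.compile (p + 1) ++ [.jump p])

theorem Cmd.length_compile (c : Cmd) (p : ℕ) : (c.compile p).length = c.length := by
  induction c generalizing p with
  | block l => rfl
  | seq c d hc hd => simp [compile, length, hc, hd]
  | ifZero a c d hc hd => simp [compile, length, hc, hd]; omega
  | loop a c hc => simp [compile, length, hc]

/-- The machine goes from `c` to `c'` in `t` steps, with all words bounded by `W`. -/
def Leads (P : Program) (W : ℕ) (c c' : Config) (t : ℕ) : Prop :=
  (step P)^[t] c = c' ∧ ∀ i ≤ t, ∀ r, ((step P)^[i] c).mem r ≤ W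

theorem Leads.refl {P : Program} {W : ℕ} {c : Config} (h : ∀ r, c.mem r ≤ W) :
    Leads P W c c 0 :=
  ⟨rfl, fun i hi => by obtain rfl : i = 0 := by omega
                       exact h⟩

theorem Leads.trans {P : Program} {W : ℕ} {c₁ c₂ c₃ : Config} {s t : ℕ}
    (h₁ : Leads P W c₁ c₂ s) (h₂ : Leads P W c₂ c₃ t) : Leads P W c₁ c₃ (s + t) := by
  refine ⟨by rw [add_comm, Function.iterate_add_apply, h₁.1, h₂.1], fun i hi r => ?_⟩
  rcases le_total i s with h | h
  · exact h₁.2 i h r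
  · obtain ⟨j, rfl⟩ := Nat.exists_eq_add_of_le h
    rw [add_comm, Function.iterate_add_apply, h₁.1]
    exact h₂.2 j (by omega) r

theorem Leads.bounded {P : Program} {W : ℕ} {c c' : Config} {t : ℕ} (h : Leads P W c c' t)
    (r : ℕ) : c'.mem r ≤ W := by
  simpa [h.1] using h.2 t le_rfl r

theorem Leads.single {P : Program} {W p : ℕ} {m : Mem} {i : Instr} {l : List Instr}
    (hm : ∀ r, m r ≤ W) (hP : i :: l <+: P.drop p)
    (hi : ∀ r, (i.exec ⟨p, m⟩).mem r ≤ W) : Leads P W ⟨p, m⟩ (i.exec ⟨p, m⟩) 1 := by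
  have h0 : P[p]? = some i := by
    obtain ⟨l', hl⟩ := hP
    have := congrArg (fun l => l[0]?) hl
    simpa using this.symm
  have h1 : step P ⟨p, m⟩ = i.exec ⟨p, m⟩ := by simp [step, h0]
  refine ⟨by simpa using h1, fun j hj r => ?_⟩
  interval_cases j
  · exact hm r
  · simpa [h1] using hi r

theorem prefix_drop_append {a b P : List Instr} {p : ℕ} (h : a ++ b <+: P.drop p) :
    a <+: P.drop p ∧ b <+: P.drop (p + a.length) := by
  refine ⟨(List.prefix_append a b).trans h, ?_⟩
  obtain ⟨l, hl⟩ := h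
  refine ⟨l, ?_⟩
  rw [← List.drop_drop, ← hl]
  simp

/-- Total correctness with a time bound: started with memory `m`, the command `c` ends after at
most `T` steps with a memory that satisfies `Q`, and no word exceeds `W` on the way. -/
def Term (W : ℕ) (c : Cmd) (m : Mem) (T : ℕ) (Q : Mem → Prop) : Prop :=
  (∀ r, m r ≤ W) → ∀ (P : Program) (p : ℕ), c.compile p <+: P.drop p →
    ∃ t ≤ T, ∃ m', Q m' ∧ Leads P W ⟨p, m⟩ ⟨p + c.length, m'⟩ t

theorem Term.mono {W : ℕ} {c : Cmd} {m : Mem} {S T : ℕ} {Q R : Mem → Prop}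
    (h : Term W c m S Q) (hT : S ≤ T) (hQ : ∀ m', Q m' → R m') : Term W c m T R := by
  intro hm P p hP
  obtain ⟨t, ht, m', hq, hl⟩ := h hm P p hP
  exact ⟨t, ht.trans hT, m', hQ _ hq, hl⟩

/-- The weakest precondition of a block of instructions. -/
def BlockSpec (W : ℕ) : List Instr → Mem → (Mem → Prop) → Prop
  | [], m, Q => Q m
  | i :: l, m, Q => ∃ d v, i.effect m = some (d, v) ∧ v ≤ W ∧
      BlockSpec W l (Function.update m d v) Q

theorem Term.block {W : ℕ} {l : List Instr} {m : Mem} {Q : Mem → Prop}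
    (h : BlockSpec W l m Q) : Term W (.block l) m l.length Q := by
  intro hm P p hP
  refine ⟨l.length, le_rfl, ?_⟩
  simp only [Cmd.compile, Cmd.length] at hP ⊢
  induction l generalizing m p with
  | nil => exact ⟨m, h, Leads.refl hm⟩
  | cons i l ih =>
    obtain ⟨d, v, he, hv, hs⟩ := h
    have hx := Instr.exec_of_effect (p := p) he
    have hm' : ∀ r, Function.update m d v r ≤ W := fun r => by
      rw [Function.update_apply]; split_ifs
      · exact hv
      · exact hm r
    have h1 := Leads.single hm hP (by rw [hx]; exact hm')
    rw [hx] at h1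
    obtain ⟨m', hq, h2⟩ := ih hs hm' (p + 1) (prefix_drop_append (a := [i]) hP).2
    refine ⟨m', hq, ?_⟩
    have := h1.trans h2
    rw [List.length_cons, add_comm l.length 1, ← add_assoc]
    exact this

theorem Term.seq {W : ℕ} {c d : Cmd} {m : Mem} {S T : ℕ} {Q : Mem → Prop}
    (h : Term W c m S fun m' => Term W d m' T Q) : Term W (.seq c d) m (S + T) Q := by
  intro hm P p hP
  obtain ⟨h1, h2⟩ := prefix_drop_append hP
  rw [Cmd.length_compile] at h2
  obtain ⟨s, hs, m1, hd, l1⟩ := h hm P p h1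
  obtain ⟨t, ht, m2, hq, l2⟩ := hd l1.bounded P _ h2
  refine ⟨s + t, by omega, m2, hq, ?_⟩
  rw [Cmd.length, ← add_assoc]
  exact l1.trans l2

theorem Term.ifZero {W : ℕ} {a : ℕ} {c d : Cmd} {m : Mem} {T : ℕ} {Q : Mem → Prop}
    (hc : m a = 0 → Term W c m T Q) (hd : m a ≠ 0 → Term W d m T Q) :
    Term W (.ifZero a c d) m (T + 2) Q := by
  intro hm P p hP
  have h0 := hP
  obtain ⟨-, hP⟩ := prefix_drop_append hP
  obtain ⟨hPd, hP⟩ := prefix_drop_append hP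
  have hj := hP
  obtain ⟨-, hPc⟩ := prefix_drop_append hP
  simp only [Cmd.length_compile, List.length_singleton] at hj hPc hPd
  have s0 := Leads.single (W := W) hm h0 (by simpa [Instr.exec] using hm)
  simp only [Instr.exec] at s0
  by_cases hz : m a = 0
  · rw [if_pos hz] at s0
    obtain ⟨t, ht, m', hq, l⟩ := hc hz hm P (p + (d.length + 2)) (by
      convert hPc using 2; omega)
    refine ⟨1 + t, by omega, m', hq, ?_⟩
    rw [Cmd.length, ← add_assoc p]
    exact s0.trans l
  · rw [if_neg hz] at s0
    obtain ⟨t, ht, m', hq, l⟩ := hd hz hm P (p + 1) hPd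
    have s1 := Leads.single (W := W) l.bounded hj (by simpa [Instr.exec] using l.bounded)
    exact ⟨1 + t + 1, by omega, m', hq, (s0.trans l).trans s1⟩

/-- The rule for loops: the potential `φ` pays for the time. -/
theorem Term.loop {W : ℕ} {a : ℕ} {c : Cmd} {Q : Mem → Prop} (I : Mem → Prop) (φ : Mem → ℕ)
    (hbody : ∀ m, I m → m a ≠ 0 → ∃ T, T + 2 ≤ φ m ∧
      Term W c m T fun m' => I m' ∧ φ m' + T + 2 ≤ φ m)
    (hQ : ∀ m, I m → m a = 0 → Q m) {m : Mem} (hI : I m) :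
    Term W (.loop a c) m (φ m + 1) Q := by
  intro hm P p hP
  have h0 := hP
  obtain ⟨-, hPc⟩ := prefix_drop_append hP
  obtain ⟨hPc, hj⟩ := prefix_drop_append hPc
  simp only [Cmd.length_compile, List.length_singleton] at hj hPc
  -- Each pass lowers the potential by the time of the body plus 2, for the test at the top and the
  -- jump back; the extra 1 in the bound pays for the final test.
  induction hn : φ m using Nat.strong_induction_on generalizing m with
  | _ n ih =>
    have s0 := Leads.single (W := W) hm h0 (by simpa [Instr.exec] using hm)
    simp only [Instr.exec] at s0
    by_cases hz : m a = 0
    · rw [if_pos hz] at s0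
      exact ⟨1, by omega, m, hQ m hI hz, s0⟩
    · rw [if_neg hz] at s0
      obtain ⟨T, hT, hterm⟩ := hbody m hI hz
      obtain ⟨t, ht, m1, ⟨hI1, hφ⟩, l⟩ := hterm hm P _ hPc
      have s1 := Leads.single (W := W) l.bounded hj (by simpa [Instr.exec] using l.bounded)
      obtain ⟨t', ht', m2, hq, l'⟩ := ih (φ m1) (by omega) hI1 l.bounded rfl
      exact ⟨1 + t + 1 + t', by omega, m2, hq, ((s0.trans l).trans s1).trans l'⟩

theorem step_of_halted {P : Program} {c : Config} (h : Halted P c) : step P c = c := by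
  simp only [Halted] at h
  simp [step, List.getElem?_eq_none h]

/-- A correct structured program yields a correct machine program. -/
theorem Term.decidesWithin {W T x y : ℕ} {c : Cmd} {Q : Prop}
    (h : Term W c (start x y).mem T fun m => (Q → m 0 = 1) ∧ (¬ Q → m 0 = 0))
    (hx : x ≤ W) (hy : y ≤ W) :
    DecidesWithin (c.compile 0) x y Q T ∧ WordsBoundedBy (c.compile 0) x y W := by
  have hm : ∀ r, (start x y).mem r ≤ W := fun r => by
    simp only [start]; split_ifs <;> omega
  obtain ⟨t, ht, m', hq, hl, hb⟩ := h hm (c.compile 0) 0 (by simp)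
  have hrun : run (c.compile 0) x y t = ⟨0 + c.length, m'⟩ := hl
  have hh : Halted (c.compile 0) ⟨0 + c.length, m'⟩ := by simp [Halted, Cmd.length_compile]
  refine ⟨⟨t, ht, by rw [hrun]; exact hh, by rw [hrun]; exact hq⟩, fun i r => ?_⟩
  rcases le_total i t with h | h
  · exact hb i h r
  -- A halted machine is frozen, so the bound at the halting time persists forever.
  · obtain ⟨j, rfl⟩ := Nat.exists_eq_add_of_le h
    have : run (c.compile 0) x y (t + j) = ⟨0 + c.length, m'⟩ := by
      rw [run, add_comm, Function.iterate_add_apply]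
      change (step _)^[j] (run _ x y t) = _
      rw [hrun]
      exact Function.iterate_fixed (step_of_halted hh) j
    rw [this, ← hrun]
    exact hb t le_rfl r

end RAM

/-! ### Antipalindromic strings in arithmetic form -/

/-- The number whose `s` digits in base `k` are the lowest `s` digits of `x`, reversed. -/
def digitRev (k : ℕ) : ℕ → ℕ → ℕ
  | 0, _ => 0
  | s + 1, x => x % k * k ^ s + digitRev k s (x / k)

/-- `x` is antipalindromic as a string of `s` digits, leading zeros being allowed. -/
def IsAPString (k s x : ℕ) : Prop := x + digitRev k s x + 1 = k ^ s

theorem IsAPString.lt {k s x : ℕ} (h : IsAPString k s x) : x < k ^ s := by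
  unfold IsAPString at h; omega

theorem digitRev_ofDigits {k : ℕ} (l : List ℕ) (hl : ∀ d ∈ l, d < k) :
    digitRev k l.length (Nat.ofDigits k l) = Nat.ofDigits k l.reverse := by
  induction l with
  | nil => rfl
  | cons d l ih =>
    have hd : d < k := hl d (by simp)
    rw [List.length_cons, digitRev, List.reverse_cons, Nat.ofDigits_append,
      ← ih fun e he => hl e (by simp [he])]
    have h1 : Nat.ofDigits k (d :: l) % k = d := by
      rw [Nat.ofDigits_cons, Nat.add_mul_mod_self_left, Nat.mod_eq_of_lt hd]
    have h2 : Nat.ofDigits k (d :: l) / k = Nat.ofDigits k l := by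
      rw [Nat.ofDigits_cons, Nat.add_mul_div_left _ _ (by omega), Nat.div_eq_of_lt hd, zero_add]
    rw [h1, h2]
    simp [Nat.ofDigits_singleton]
    ring

/-- A digit and its complement add up to k - 1, so the sum has all digits k - 1 and no carries
arise. -/
theorem ofDigits_add_ofDigits_compl {k : ℕ} (hk : 0 < k) (l : List ℕ) (hl : ∀ d ∈ l, d < k) :
    Nat.ofDigits k l + Nat.ofDigits k (l.map fun a => k - 1 - a) + 1 = k ^ l.length := by
  induction l with
  | nil => simp
  | cons d l ih =>
    have hd : d < k := hl d (by simp)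
    have := ih fun e he => hl e (by simp [he])
    rw [List.map_cons, Nat.ofDigits_cons, Nat.ofDigits_cons, List.length_cons, pow_succ, ← this]
    obtain ⟨e, rfl⟩ : ∃ e, k = d + e + 1 := ⟨k - 1 - d, by omega⟩
    have : d + e + 1 - 1 - d = e := by omega
    rw [this]
    ring

/-- Digit strings of equal length coincide exactly when their values do, and the complement of n has
value k ^ length - 1 - n. This turns the digit condition into one equation, which the machine can
test. -/
theorem isAntipalindromic_iff_digits_length {k n : ℕ} (hk : 2 ≤ k) :
    IsAntipalindromic k n ↔ 0 < n ∧ IsAPString k (Nat.digits k n).length n := by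
  refine and_congr_right fun hn => ?_
  have hd : ∀ d ∈ Nat.digits k n, d < k := fun d h => Nat.digits_lt_base hk h
  have h1 := digitRev_ofDigits _ hd
  have h2 := ofDigits_add_ofDigits_compl (by omega) _ hd
  rw [Nat.ofDigits_digits] at h1 h2
  rw [IsAPString, h1]
  constructor
  · intro h
    rw [h]; exact h2
  · intro h
    refine Nat.ofDigits_inj_of_len_eq (b := k) (by omega) (by simp) (fun d h => hd d (by simpa using h))
      (fun d h => ?_) (by omega)
    obtain ⟨a, -, rfl⟩ := List.mem_map.1 h
    omega

theorem isAntipalindromic_iff {k n : ℕ} (hk : 2 ≤ k) :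
    IsAntipalindromic k n ↔ ∃ s, IsAPString k (s + 1) n ∧ k ^ s ≤ n := by
  rw [isAntipalindromic_iff_digits_length hk]
  constructor
  · rintro ⟨hn, h⟩
    have hne : Nat.digits k n ≠ [] := Nat.digits_ne_nil_iff_ne_zero.2 hn.ne'
    obtain ⟨s, hs⟩ := Nat.exists_eq_succ_of_ne_zero (List.length_pos_iff.2 hne).ne'
    refine ⟨s, by rwa [hs] at h, ?_⟩
    have := Nat.base_pow_length_digits_le k n hk hn.ne'
    rw [hs, pow_succ, mul_comm] at this
    exact Nat.le_of_mul_le_mul_left this (by omega)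
  · rintro ⟨s, h, hs⟩
    refine ⟨lt_of_lt_of_le (by positivity) hs, ?_⟩
    have : (Nat.digits k n).length = s + 1 := by
      apply le_antisymm
      · exact (Nat.digits_length_le_iff hk n).2 h.lt
      · exact (Nat.lt_digits_length_iff hk n).2 hs
    rwa [this]

theorem digitRev_add_mul_pow {k : ℕ} (s x d : ℕ) (hk : 0 < k) (hx : x < k ^ s) (hd : d < k) :
    digitRev k (s + 1) (x + d * k ^ s) = k * digitRev k s x + d := by
  induction s generalizing x with
  | zero =>
    obtain rfl : x = 0 := by simpa using hx
    simp [digitRev, Nat.mod_eq_of_lt hd]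
  | succ s ih =>
    rw [digitRev]
    have h1 : (x + d * k ^ (s + 1)) % k = x % k := by
      rw [pow_succ, ← mul_assoc, Nat.add_mul_mod_self_right]
    have h2 : (x + d * k ^ (s + 1)) / k = x / k + d * k ^ s := by
      rw [pow_succ, ← mul_assoc, Nat.add_mul_div_right _ _ hk]
    rw [h1, h2, ih _ (Nat.div_lt_of_lt_mul (by rwa [pow_succ'] at hx)), digitRev]
    ring

theorem isAPString_zero {k x : ℕ} : IsAPString k 0 x ↔ x = 0 := by
  simp [IsAPString, digitRev]

theorem isAPString_one {k x : ℕ} (hk : 0 < k) : IsAPString k 1 x ↔ 2 * x + 1 = k := by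
  simp only [IsAPString, digitRev, pow_zero, pow_one, mul_one, add_zero]
  constructor
  · intro h
    rw [Nat.mod_eq_of_lt (by omega)] at h; omega
  · intro h
    rw [Nat.mod_eq_of_lt (by omega)]; omega

/-- The value of the string of `n + 2` digits with lowest digit `a`, highest digit `k - 1 - a` and
the string `x` in between. -/
def wrap (k n a x : ℕ) : ℕ := a + k * x + (k - 1 - a) * k ^ (n + 1)

/-- Modulo k the defining equation leaves k ∣ a + d + 1, and 0 < a + d + 1 < 2 * k forces equality.
The outer contributions then cancel and a factor k can be removed. -/
theorem isAPString_wrap_aux {k n a d x : ℕ} (ha : a < k) (hd : d < k) (hx : x < k ^ n) :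
    IsAPString k (n + 2) (a + k * x + d * k ^ (n + 1)) ↔ a + d + 1 = k ∧ IsAPString k n x := by
  have hlt : a + k * x < k ^ (n + 1) := by
    rw [pow_succ']; nlinarith
  rw [IsAPString, digitRev_add_mul_pow (n + 1) _ d (by omega) hlt hd, digitRev,
    Nat.add_mul_mod_self_left, Nat.mod_eq_of_lt ha, Nat.add_mul_div_left _ _ (by omega),
    Nat.div_eq_of_lt ha, zero_add, IsAPString]
  set r := digitRev k n x
  have e : k ^ (n + 1) = k ^ n * k := pow_succ _ _
  have e2 : k ^ (n + 2) = k ^ n * k * k := by rw [pow_succ, pow_succ]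
  rw [e, e2]
  set p := k ^ n
  have hp : 0 < p := by omega
  constructor
  · intro h
    have hmod : k ∣ a + d + 1 := by
      have : a + d + 1 + k * (x + d * p + a * p + r) = k * (p * k) := by linarith
      exact (Nat.dvd_add_left (Dvd.intro _ rfl)).1 (this ▸ Dvd.intro _ rfl)
    obtain ⟨j, hj⟩ := hmod
    have hj1 : j = 1 := by
      have : j < 2 := by
        by_contra hc
        have : k * 2 ≤ k * j := Nat.mul_le_mul_left _ (by omega)
        omega
      have : j ≠ 0 := by rintro rfl; omega
      omega
    subst hj1
    refine ⟨by omega, ?_⟩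
    have hk : 0 < k := by omega
    have hm : (a + d + 1) * (p * k) = k * (p * k) := by rw [hj, mul_one]
    have h3 : k * (x + r + 1) = k * p := by linarith
    exact Nat.eq_of_mul_eq_mul_left hk h3
  · rintro ⟨h1, h2⟩
    obtain rfl : k = a + d + 1 := h1.symm
    nlinarith

theorem isAPString_wrap {k n a x : ℕ} (ha : a < k) (hx : IsAPString k n x) :
    IsAPString k (n + 2) (wrap k n a x) :=
  (isAPString_wrap_aux ha (by omega) hx.lt).2 ⟨by omega, hx⟩

theorem IsAPString.exists_wrap {k n y : ℕ} (h : IsAPString k (n + 2) y) :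
    ∃ a x, a < k ∧ IsAPString k n x ∧ y = wrap k n a x := by
  have hk : 0 < k := by
    rcases Nat.eq_zero_or_pos k with rfl | hk
    · simp [IsAPString] at h
    · exact hk
  have hlt := h.lt
  set z := y % k ^ (n + 1)
  set d := y / k ^ (n + 1)
  have hy : y = z + d * k ^ (n + 1) := by rw [mul_comm]; exact (Nat.mod_add_div _ _).symm
  have hz : z < k ^ (n + 1) := Nat.mod_lt _ (by positivity)
  have hd : d < k := Nat.div_lt_of_lt_mul (by rwa [pow_succ] at hlt)
  have hz' : z = z % k + k * (z / k) := (Nat.mod_add_div _ _).symm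
  have ha : z % k < k := Nat.mod_lt _ hk
  have hx : z / k < k ^ n := Nat.div_lt_of_lt_mul (by rwa [pow_succ'] at hz)
  rw [hy, hz'] at h
  obtain ⟨h1, h2⟩ := (isAPString_wrap_aux ha hd hx).1 h
  refine ⟨z % k, z / k, ha, h2, ?_⟩
  rw [wrap, ← hz', show k - 1 - z % k = d by omega, ← hy]

theorem pow_le_wrap_iff {k n a x : ℕ} (ha : a < k) (hx : x < k ^ n) :
    k ^ (n + 1) ≤ wrap k n a x ↔ a + 1 < k := by
  constructor
  · intro h
    by_contra hc
    obtain rfl : k = a + 1 := by omega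
    have h1 : a + 1 - 1 - a = 0 := by omega
    rw [wrap, h1, pow_succ'] at h
    nlinarith
  · intro h
    have : k ^ (n + 1) ≤ (k - 1 - a) * k ^ (n + 1) := Nat.le_mul_of_pos_left _ (by omega)
    rw [wrap]; omega

/-! ### The transition system of carries and excesses -/

/-- The inner part of a multiplication `N * B = A` of antipalindromic numbers: `x` and `y` are
the inner parts of `B` and `A`, with `n` and `n + s` digits; `c` is the carry from below, and
`E - N` is the excess of the outer digits of `N * B` over those of `A`.  For `f = 1` the leading
digits of `x` and `y` are not zero. -/
def Fits (k N s f n c E : ℕ) : Prop :=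
  ∃ x y, IsAPString k n x ∧ IsAPString k (n + s) y ∧ f * k ^ (n - 1) ≤ x ∧
    f * k ^ (n + s - 1) ≤ y ∧ N * x + c + E * k ^ n = y + N * k ^ n

/-- From x < k ^ n and c < N follows N * x + c < N * k ^ n, so E = 0 is impossible; y < k ^ (n + s)
gives the upper bound. This makes the graph finite. -/
theorem Fits.bounds {k N s f n c E : ℕ} (hc : c < N) (h : Fits k N s f n c E) :
    0 < E ∧ E < N + k ^ s := by
  obtain ⟨x, y, hx, hy, -, -, e⟩ := h
  have hx := hx.lt
  have hy := hy.lt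
  rw [pow_add] at hy
  set p := k ^ n
  have hp : 0 < p := by omega
  constructor
  · by_contra h0
    obtain rfl : E = 0 := by omega
    nlinarith
  · by_contra h0
    push Not at h0
    have := Nat.mul_le_mul_right p h0
    nlinarith

/-- The digit of `A` that comes from the digit `b` of `B` and the carry `c`. -/
def outDigit (k N c b : ℕ) : ℕ := (N * b + c) % k

/-- The carry produced by the digit `b` and the carry `c`. -/
def nextCarry (k N c b : ℕ) : ℕ := (N * b + c) / k

/-- The excess after the outer digits of `B` and `A` have been split off. -/
def nextExcess (k N K c E b : ℕ) : ℕ := k * E - (N * b + (k - 1 - outDigit k N c b) * K)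

/-- The digit `b` can be split off. -/
def Allowed (k N K f c E b : ℕ) : Prop :=
  b + f < k ∧ outDigit k N c b + f < k ∧ 0 < nextExcess k N K c E b ∧
    nextExcess k N K c E b < N + K

theorem nextCarry_lt {k N c b : ℕ} (hb : b < k) (hc : c < N) : nextCarry k N c b < N := by
  apply Nat.div_lt_of_lt_mul
  nlinarith

theorem outDigit_add_nextCarry (k N c b : ℕ) :
    N * b + c = outDigit k N c b + k * nextCarry k N c b := (Nat.mod_add_div _ _).symm

/-- After cancelling the common lowest digit a and using N * (k - 1 - b) + N * b + N = N * k, the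
first equation is k times the second. -/
theorem mul_wrap_eq_iff {k N s n a b c c' x y E : ℕ} (hv : N * b + c = a + k * c') (hb : b < k) :
    N * wrap k n b x + c + E * k ^ (n + 2) = wrap k (n + s) a y + N * k ^ (n + 2) ↔
      N * x + c' + k * E * k ^ n = y + (N * b + (k - 1 - a) * k ^ s + N) * k ^ n := by
  have hkpos : 0 < k := by omega
  have hN : N * (k - 1 - b) + N * b + N = N * k := by
    conv_rhs => rw [show k = (k - 1 - b) + b + 1 by omega]
    ring
  rw [wrap, wrap]
  generalize k - 1 - b = d at *
  generalize k - 1 - a = g at *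
  rw [show k ^ (n + 1) = k * k ^ n from pow_succ' _ _,
    show k ^ (n + 2) = k * (k * k ^ n) by rw [pow_succ', pow_succ'],
    show k ^ (n + s + 1) = k * (k ^ n * k ^ s) by rw [pow_succ', pow_add]]
  generalize k ^ n = p at *
  generalize k ^ s = K at *
  have h2 : (N * d + N * b + N) * (k * p) = N * k * (k * p) := by rw [hN]
  rw [← Nat.mul_right_inj hkpos.ne' (a := k) (b := N * x + c' + k * E * p)]
  constructor <;> intro H <;> linarith

/-- The digit b is the only choice: the lowest digit of A is forced modulo k. The condition on
leading digits concerns only the outermost layer, hence f becomes 0 inside. -/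
theorem fits_step {k N s f n c E : ℕ} (hf : f ≤ 1) (hc : c < N) :
    Fits k N s f (n + 2) c E ↔ ∃ b, Allowed k N (k ^ s) f c E b ∧
      Fits k N s 0 n (nextCarry k N c b) (nextExcess k N (k ^ s) c E b) := by
  have hlead : ∀ {n a x : ℕ}, a < k → IsAPString k n x →
      (f * k ^ (n + 1) ≤ wrap k n a x ↔ a + f < k) := by
    intro n a x ha hx
    interval_cases f
    · simpa using ha
    · simpa using pow_le_wrap_iff ha hx.lt
  constructor
  · rintro ⟨x, y, hx, hy, hfx, hfy, e⟩
    obtain ⟨b, x', hb, hx', rfl⟩ := hx.exists_wrap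
    rw [show n + 2 + s = (n + s) + 2 by ring] at hy
    obtain ⟨a, y', ha, hy', rfl⟩ := hy.exists_wrap
    have hb' := (hlead hb hx').1 hfx
    have ha' := (hlead ha hy').1 (by
      convert hfy using 3; omega)
    have hv := outDigit_add_nextCarry k N c b
    have hao : outDigit k N c b = a := by
      have h1 : (N * wrap k n b x' + c + E * k ^ (n + 2)) % k = (N * b + c) % k := by
        have : N * wrap k n b x' + c + E * k ^ (n + 2) =
            N * b + c + k * (N * x' + N * (k - 1 - b) * k ^ n + E * (k ^ n * k)) := by
          rw [wrap]; ring
        rw [this, Nat.add_mul_mod_self_left]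
      have h2 : (wrap k (n + s) a y' + N * k ^ (n + 2)) % k = a := by
        have : wrap k (n + s) a y' + N * k ^ (n + 2) =
            a + k * (y' + (k - 1 - a) * k ^ (n + s) + N * (k ^ n * k)) := by
          rw [wrap]; ring
        rw [this, Nat.add_mul_mod_self_left, Nat.mod_eq_of_lt ha]
      rw [outDigit, ← h1, e, h2]
    rw [hao] at hv
    have e' := (mul_wrap_eq_iff hv hb).1 e
    have hc' := nextCarry_lt hb hc
    set c' := nextCarry k N c b
    -- The subtraction in `nextExcess` does not truncate: otherwise N * x' + c' would reach N * k ^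
    -- n.
    have hgt : N * b + (k - 1 - a) * k ^ s < k * E := by
      by_contra hcon
      push Not at hcon
      have h1 := Nat.mul_le_mul_right (k ^ n) hcon
      have h2 := hx'.lt
      nlinarith
    have hE : nextExcess k N (k ^ s) c E b + (N * b + (k - 1 - a) * k ^ s) = k * E := by
      rw [nextExcess, hao]; omega
    have hfit : Fits k N s 0 n c' (nextExcess k N (k ^ s) c E b) := by
      refine ⟨x', y', hx', hy', by simp, by simp, ?_⟩
      rw [← hE] at e'
      linarith
    exact ⟨b, ⟨hb', by rwa [hao], hfit.bounds hc'⟩, hfit⟩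
  · rintro ⟨b, ⟨hb', ha', hpos, -⟩, x', y', hx', hy', -, -, e⟩
    have hv := outDigit_add_nextCarry k N c b
    have hb : b < k := by omega
    have ha : outDigit k N c b < k := by omega
    -- Here positivity of the new excess, part of `Allowed`, rules out truncation.
    have hE : nextExcess k N (k ^ s) c E b +
        (N * b + (k - 1 - outDigit k N c b) * k ^ s) = k * E := by
      rw [nextExcess] at hpos ⊢; omega
    refine ⟨wrap k n b x', wrap k (n + s) (outDigit k N c b) y', isAPString_wrap hb hx', ?_,
      (hlead hb hx').2 hb', ?_, (mul_wrap_eq_iff hv hb).2 ?_⟩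
    · have := isAPString_wrap ha hy'
      rwa [show n + 2 + s = (n + s) + 2 by ring]
    · have := (hlead ha hy').2 ha'
      convert this using 3; omega
    · rw [← hE]; linarith

theorem fits_zero {k N s c E : ℕ} :
    Fits k N s 0 0 c E ↔ N ≤ E + c ∧ IsAPString k s (E + c - N) := by
  simp only [Fits, isAPString_zero, zero_add, zero_mul, zero_le, true_and, pow_zero, mul_one]
  constructor
  · rintro ⟨x, y, rfl, hy, e⟩
    have : E + c - N = y := by omega
    exact ⟨by omega, this ▸ hy⟩
  · rintro ⟨h, hy⟩
    exact ⟨0, _, rfl, hy, by omega⟩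

theorem fits_one {k N s f c E : ℕ} (hk : 2 ≤ k) (hf : f ≤ 1) :
    Fits k N s f 1 c E ↔ k % 2 = 1 ∧ k * N + f * k ^ s ≤ k * E + N * (k / 2) + c ∧
      IsAPString k (s + 1) (k * E + N * (k / 2) + c - k * N) := by
  simp only [Fits, isAPString_one (show 0 < k by omega), pow_one]
  rw [add_comm 1 s]
  simp only [Nat.add_sub_cancel]
  constructor
  · rintro ⟨x, y, hx, hy, -, hfy, e⟩
    have hx2 : k / 2 = x := by omega
    rw [hx2]
    have e1 : k * E + N * x + c = y + k * N := by linarith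
    rw [e1, Nat.add_sub_cancel]
    exact ⟨by omega, by omega, hy⟩
  · rintro ⟨h1, h2, h3⟩
    refine ⟨k / 2, _, by omega, h3, ?_, ?_, ?_⟩
    -- For f = 1 the middle digit must be nonzero; it is, because an odd k ≥ 2 is at least 3.
    · interval_cases f <;> simp; omega
    · omega
    · have := Nat.sub_add_cancel (le_trans (Nat.le_add_right _ _) h2)
      linarith

theorem isAntipalindromicQuotient_zero (k : ℕ) : ¬ IsAntipalindromicQuotient k 0 := by
  rintro ⟨A, B, hA, hB, h⟩
  have h1 : (0 : ℚ) < A := by exact_mod_cast hA.1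
  have h2 : (0 : ℚ) < B := by exact_mod_cast hB.1
  have := div_pos h1 h2
  rw [← h, Nat.cast_zero] at this
  exact lt_irrefl _ this

/-- Initially there is no carry, and excess N encodes discrepancy zero. The bound on s comes from k
^ (n + s) ≤ A = N * B < N * k ^ (n + 1). -/
theorem isAntipalindromicQuotient_iff {k N : ℕ} (hk : 2 ≤ k) (hN : 0 < N) :
    IsAntipalindromicQuotient k N ↔ ∃ s n, k ^ s < k * N ∧ Fits k N s 1 (n + 1) 0 N := by
  constructor
  · rintro ⟨A, B, hA, hB, h⟩
    have hB0 : (B : ℚ) ≠ 0 := by exact_mod_cast hB.1.ne'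
    have e : N * B = A := by
      rw [eq_div_iff hB0] at h; exact_mod_cast h
    obtain ⟨m, hA1, hA2⟩ := (isAntipalindromic_iff hk).1 hA
    obtain ⟨n, hB1, hB2⟩ := (isAntipalindromic_iff hk).1 hB
    have hle : n ≤ m := by
      have h1 : k ^ n < k ^ (m + 1) := by
        calc k ^ n ≤ B := hB2
          _ ≤ N * B := Nat.le_mul_of_pos_left _ hN
          _ = A := e
          _ < _ := hA1.lt
      have := (Nat.pow_lt_pow_iff_right (by omega)).1 h1
      omega
    obtain ⟨s, rfl⟩ := Nat.exists_eq_add_of_le hle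
    refine ⟨s, n, ?_, B, A, hB1, ?_, by simpa using hB2, ?_, by rw [e]; ring⟩
    · have h1 : k ^ n * k ^ s < k ^ n * (k * N) := by
        calc k ^ n * k ^ s = k ^ (n + s) := (pow_add _ _ _).symm
          _ ≤ N * B := by rw [e]; exact hA2
          _ < N * k ^ (n + 1) := Nat.mul_lt_mul_of_pos_left hB1.lt hN
          _ = _ := by ring
      exact Nat.lt_of_mul_lt_mul_left h1
    · convert hA1 using 1; ring
    · rw [one_mul]; convert hA2 using 2; omega
  · rintro ⟨s, n, -, B, A, hB1, hA1, hB2, hA2, e⟩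
    have e' : N * B = A := by omega
    have hB : IsAntipalindromic k B := (isAntipalindromic_iff hk).2 ⟨n, hB1, by simpa using hB2⟩
    refine ⟨A, B, (isAntipalindromic_iff hk).2 ⟨n + s, ?_, ?_⟩, hB, ?_⟩
    · convert hA1 using 1; ring
    · rw [one_mul] at hA2; convert hA2 using 2; omega
    · have hB0 : (B : ℚ) ≠ 0 := by exact_mod_cast hB.1.ne'
      rw [eq_div_iff hB0]; exact_mod_cast e'

/-! ### Coded pairs and the abstract breadth first search -/

/-- A pair of a carry `c < N` and an excess `E` is coded by `c + N * E`. -/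
def nextCode (k N K q b : ℕ) : ℕ :=
  nextCarry k N (q % N) b + N * nextExcess k N K (q % N) (q / N) b

/-- The condition `Fits` for a coded pair. -/
def CodeFits (k N s f n q : ℕ) : Prop := Fits k N s f n (q % N) (q / N)

/-- The condition `Allowed` for a coded pair. -/
def CodeAllowed (k N K f q b : ℕ) : Prop := Allowed k N K f (q % N) (q / N) b

/-- The inner part can consist of at most one digit. -/
def Accepting (k N s q : ℕ) : Prop := CodeFits k N s 0 0 q ∨ CodeFits k N s 0 1 q

theorem nextCode_mod {k N K q b : ℕ} (hN : 0 < N) (hb : b < k) :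
    nextCode k N K q b % N = nextCarry k N (q % N) b := by
  rw [nextCode, Nat.add_mul_mod_self_left,
    Nat.mod_eq_of_lt (nextCarry_lt hb (Nat.mod_lt _ hN))]

theorem nextCode_div {k N K q b : ℕ} (hN : 0 < N) (hb : b < k) :
    nextCode k N K q b / N = nextExcess k N K (q % N) (q / N) b := by
  rw [nextCode, Nat.add_mul_div_left _ _ hN,
    Nat.div_eq_of_lt (nextCarry_lt hb (Nat.mod_lt _ hN)), zero_add]

theorem codeFits_step {k N s f n q : ℕ} (hf : f ≤ 1) (hN : 0 < N) :
    CodeFits k N s f (n + 2) q ↔ ∃ b, CodeAllowed k N (k ^ s) f q b ∧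
      CodeFits k N s 0 n (nextCode k N (k ^ s) q b) := by
  rw [CodeFits, fits_step hf (Nat.mod_lt _ hN)]
  refine exists_congr fun b => and_congr_right fun h => ?_
  have hb : b < k := by have := h.1; omega
  rw [CodeFits, nextCode_mod hN hb, nextCode_div hN hb]

theorem nextCode_lt {k N K f q b : ℕ} (hN : 0 < N) (h : CodeAllowed k N K f q b) :
    nextCode k N K q b < N * (N + K) := by
  have hc : nextCarry k N (q % N) b < N :=
    nextCarry_lt (by have := h.1; omega) (Nat.mod_lt _ hN)
  have hE := h.2.2.2
  rw [nextCode]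
  nlinarith

/-- The state of the breadth first search. -/
structure SearchState where
  mark : ℕ → ℕ
  queue : ℕ → ℕ
  head : ℕ
  tail : ℕ
  digit : ℕ
  ans : ℕ

namespace SearchState

/-- Put a new code into the queue. -/
def push (K q : ℕ) (σ : SearchState) : SearchState :=
  { σ with mark := Function.update σ.mark q K, queue := Function.update σ.queue σ.tail q,
           tail := σ.tail + 1 }

open Classical in
/-- Record whether the code `q` is accepting. -/
noncomputable def test (k N s q : ℕ) (σ : SearchState) : SearchState :=
  { σ with ans := if Accepting k N s q then 1 else σ.ans }

/-- The code that the current digit leads to. -/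
def next (k N s : ℕ) (σ : SearchState) : ℕ :=
  nextCode k N (k ^ s) (σ.queue σ.head) σ.digit

open Classical in
/-- Follow the transition from the head of the queue that is given by the current digit. -/
noncomputable def expand (k N s : ℕ) (σ : SearchState) : SearchState :=
  if CodeAllowed k N (k ^ s) (1 - σ.head) (σ.queue σ.head) σ.digit ∧
      σ.mark (σ.next k N s) ≠ k ^ s then
    (σ.push (k ^ s) (σ.next k N s)).test k N s (σ.next k N s)
  else σ

/-- Go on to the next digit. -/
def advance (k : ℕ) (σ : SearchState) : SearchState :=
  if σ.digit + 1 < k then { σ with digit := σ.digit + 1 }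
  else { σ with digit := 0, head := σ.head + 1 }

/-- The invariant of the search. The entry `0` of the queue is the initial pair, and the others
are the marked codes.  `H` is what is known as long as the answer is `0`, and `G` is the
question. -/
structure Inv (k N s : ℕ) (H G : Prop) (σ : SearchState) : Prop where
  digit_lt : σ.digit < k
  head_le : σ.head ≤ σ.tail
  digit_eq : σ.head = σ.tail → σ.digit = 0
  queue_zero : σ.queue 0 = N * N
  tail_pos : 0 < σ.tail
  queue_lt : ∀ j, 0 < j → j < σ.tail → σ.queue j < N * (N + k ^ s)
  exists_of_mark : ∀ q, σ.mark q = k ^ s → ∃ j, 0 < j ∧ j < σ.tail ∧ σ.queue j = q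
  mark_le : ∀ q, σ.mark q ≤ k ^ s
  tail_eq : σ.tail = 1 + ((Finset.range (N * (N + k ^ s))).filter (σ.mark · = k ^ s)).card
  ans_le : σ.ans ≤ 1
  of_ans : σ.ans = 1 → G
  of_ans_zero : σ.ans = 0 → H
  sound : ∀ j, j < σ.tail → ∀ n, CodeFits k N s (1 - j) (n + (1 - j)) (σ.queue j) → G
  not_accepting : σ.ans = 0 → ∀ j, 0 < j → j < σ.tail → ¬ Accepting k N s (σ.queue j)
  closed : ∀ j b, (j < σ.head ∨ j = σ.head ∧ b < σ.digit) →
    CodeAllowed k N (k ^ s) (1 - j) (σ.queue j) b →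
      σ.mark (nextCode k N (k ^ s) (σ.queue j) b) = k ^ s

variable {k N s : ℕ} {H G : Prop} {σ : SearchState}

theorem Inv.tail_le (h : Inv k N s H G σ) : σ.tail ≤ 1 + N * (N + k ^ s) := by
  rw [h.tail_eq]
  have := Finset.card_filter_le (Finset.range (N * (N + k ^ s))) (σ.mark · = k ^ s)
  rw [Finset.card_range] at this
  omega

theorem Inv.queue_le (h : Inv k N s H G σ) {j : ℕ} (hj : j < σ.tail) :
    σ.queue j ≤ N * (N + k ^ s) := by
  rcases Nat.eq_zero_or_pos j with rfl | h0
  · rw [h.queue_zero]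
    exact Nat.mul_le_mul_left _ (Nat.le_add_right _ _)
  · exact (h.queue_lt j h0 hj).le

/-- Soundness is pulled back along the edge: an inner part fitting the new code, wrapped in the
current digit, fits the head of the queue. The new code is unmarked and in range, so the count of
marks grows by exactly one. -/
theorem Inv.push_test (h : Inv k N s H G σ) (hN : 0 < N) (hlt : σ.head < σ.tail)
    (ha : CodeAllowed k N (k ^ s) (1 - σ.head) (σ.queue σ.head) σ.digit)
    (hm : σ.mark (nextCode k N (k ^ s) (σ.queue σ.head) σ.digit) ≠ k ^ s) :
    Inv k N s H G ((σ.push (k ^ s) (nextCode k N (k ^ s) (σ.queue σ.head) σ.digit)).test k N s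
      (nextCode k N (k ^ s) (σ.queue σ.head) σ.digit)) := by
  classical
  have hqlt := nextCode_lt hN ha
  have hsound : ∀ n, CodeFits k N s 0 n (nextCode k N (k ^ s) (σ.queue σ.head) σ.digit) → G := by
    intro n hn
    -- The truncated 1 - j equals 1 only for the initial entry j = 0, where leading digits must be
    -- nonzero and the length is at least 1; the witness compensates for that offset.
    refine h.sound σ.head hlt (n + 2 - (1 - σ.head)) ?_
    rw [Nat.sub_add_cancel (by omega)]
    exact (codeFits_step (by omega) hN).2 ⟨_, ha, hn⟩
  set q := nextCode k N (k ^ s) (σ.queue σ.head) σ.digit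
  have hold : ∀ j, j < σ.tail → Function.update σ.queue σ.tail q j = σ.queue j :=
    fun j hj => Function.update_of_ne hj.ne _ _
  have htail : Function.update σ.queue σ.tail q σ.tail = q := Function.update_self _ _ _
  have hmk : ∀ r, Function.update σ.mark q (k ^ s) r = k ^ s ↔ r = q ∨ σ.mark r = k ^ s := by
    intro r
    rw [Function.update_apply]
    split_ifs with hr <;> simp [hr]
  refine ⟨h.digit_lt, h.head_le.trans (Nat.le_succ _), ?_, ?_, Nat.succ_pos _, ?_, ?_, ?_, ?_,
    ?_, ?_, ?_, ?_, ?_, ?_⟩ <;> simp only [test, push]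
  · intro he; omega
  · rw [hold _ h.tail_pos, h.queue_zero]
  · intro j h0 hj
    rcases Nat.lt_succ_iff_lt_or_eq.1 hj with hj | rfl
    · rw [hold j hj]; exact h.queue_lt j h0 hj
    · rwa [htail]
  · intro r hr
    rcases (hmk r).1 hr with rfl | hr
    · exact ⟨σ.tail, h.tail_pos, Nat.lt_succ_self _, htail⟩
    · obtain ⟨j, h0, hj, rfl⟩ := h.exists_of_mark r hr
      exact ⟨j, h0, by omega, hold j hj⟩
  · intro r
    rw [Function.update_apply]
    split_ifs
    · exact le_rfl
    · exact h.mark_le r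
  · have : (Finset.range (N * (N + k ^ s))).filter (Function.update σ.mark q (k ^ s) · = k ^ s) =
        insert q ((Finset.range (N * (N + k ^ s))).filter (σ.mark · = k ^ s)) := by
      ext r
      simp only [Finset.mem_filter, Finset.mem_range, Finset.mem_insert, hmk]
      constructor
      · tauto
      · rintro (rfl | hr)
        · exact ⟨hqlt, Or.inl rfl⟩
        · exact ⟨hr.1, Or.inr hr.2⟩
    have hcard : σ.tail + 1 = 1 + ((Finset.range (N * (N + k ^ s))).filter
        (Function.update σ.mark q (k ^ s) · = k ^ s)).card := by
      rw [this, Finset.card_insert_of_notMem (by simp [hm]), ← add_assoc,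
        Nat.add_right_cancel_iff]
      exact h.tail_eq
    exact hcard
  · split_ifs
    · exact le_rfl
    · exact h.ans_le
  · split_ifs with hacc
    · exact fun _ => hacc.elim (hsound 0) (hsound 1)
    · exact h.of_ans
  · split_ifs with hacc
    · simp
    · exact h.of_ans_zero
  · intro j hj n
    rcases Nat.lt_succ_iff_lt_or_eq.1 hj with hj | rfl
    · rw [hold j hj]; exact h.sound j hj n
    · have := h.tail_pos
      rw [htail, show 1 - σ.tail = 0 by omega]
      exact hsound n
  · split_ifs with hacc
    · simp
    · intro h0 j hj0 hj
      rcases Nat.lt_succ_iff_lt_or_eq.1 hj with hj | rfl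
      · rw [hold j hj]; exact h.not_accepting h0 j hj0 hj
      · rwa [htail]
  · intro j b hj
    rw [hold j (by omega), hmk]
    exact fun hb => Or.inr (h.closed j b hj hb)

theorem Inv.expand (h : Inv k N s H G σ) (hN : 0 < N) (hlt : σ.head < σ.tail) :
    Inv k N s H G (σ.expand k N s) := by
  unfold SearchState.expand
  split_ifs with hc
  · exact h.push_test hN hlt hc.1 hc.2
  · exact h

theorem expand_head : (σ.expand k N s).head = σ.head := by
  unfold SearchState.expand
  split_ifs <;> rfl

theorem expand_digit : (σ.expand k N s).digit = σ.digit := by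
  unfold SearchState.expand
  split_ifs <;> rfl

theorem tail_le_expand_tail : σ.tail ≤ (σ.expand k N s).tail := by
  unfold SearchState.expand
  split_ifs
  · exact Nat.le_succ _
  · exact le_rfl

theorem expand_closed (hlt : σ.head < σ.tail)
    (ha : CodeAllowed k N (k ^ s) (1 - σ.head) (σ.queue σ.head) σ.digit) :
    (σ.expand k N s).mark (nextCode k N (k ^ s) ((σ.expand k N s).queue σ.head) σ.digit) =
      k ^ s := by
  unfold SearchState.expand
  split_ifs with hc
  · simp only [test, push, Function.update_of_ne hlt.ne, next, Function.update_self]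
  · by_contra hm
    exact hc ⟨ha, hm⟩

theorem Inv.advance (h : Inv k N s H G σ) (hlt : σ.head < σ.tail)
    (hc : CodeAllowed k N (k ^ s) (1 - σ.head) (σ.queue σ.head) σ.digit →
      σ.mark (nextCode k N (k ^ s) (σ.queue σ.head) σ.digit) = k ^ s) :
    Inv k N s H G (σ.advance k) := by
  have hd := h.digit_lt
  unfold SearchState.advance
  split_ifs with hk
  · refine ⟨hk, h.head_le, fun he => absurd he hlt.ne, h.queue_zero, h.tail_pos, h.queue_lt,
      h.exists_of_mark, h.mark_le, h.tail_eq, h.ans_le, h.of_ans, h.of_ans_zero, h.sound,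
      h.not_accepting, ?_⟩
    rintro j b (hj | ⟨rfl, hb⟩)
    · exact h.closed j b (Or.inl hj)
    · rcases Nat.lt_succ_iff_lt_or_eq.1 hb with hb | rfl
      · exact h.closed _ b (Or.inr ⟨rfl, hb⟩)
      · exact hc
  · refine ⟨by simp only; omega, hlt, fun _ => rfl, h.queue_zero, h.tail_pos, h.queue_lt,
      h.exists_of_mark, h.mark_le, h.tail_eq, h.ans_le, h.of_ans, h.of_ans_zero, h.sound,
      h.not_accepting, ?_⟩
    rintro j b (hj | ⟨-, hb⟩) hab
    · rcases Nat.lt_succ_iff_lt_or_eq.1 hj with hj | rfl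
      · exact h.closed j b (Or.inl hj) hab
      · have hbk : b < k := by have := hab.1; omega
        rcases Nat.lt_or_ge b σ.digit with hb | hb
        · exact h.closed _ b (Or.inr ⟨rfl, hb⟩) hab
        · obtain rfl : b = σ.digit := by omega
          exact hc hab
    · exact absurd hb (Nat.not_lt_zero _)

theorem Inv.step (h : Inv k N s H G σ) (hN : 0 < N) (hlt : σ.head < σ.tail) :
    Inv k N s H G ((σ.expand k N s).advance k) := by
  have hq : (σ.expand k N s).queue σ.head = σ.queue σ.head := by
    unfold SearchState.expand
    split_ifs
    · simp only [test, push, Function.update_of_ne hlt.ne]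
    · rfl
  refine (h.expand hN hlt).advance ?_ ?_
  · rw [expand_head]; exact hlt.trans_le tail_le_expand_tail
  · rw [expand_head, expand_digit]
    intro ha
    rw [hq] at ha
    exact expand_closed hlt ha

/-- The number of transitions that are still to be looked at decreases. -/
theorem Inv.remaining_step (h : Inv k N s H G σ) (hlt : σ.head < σ.tail) {M : ℕ}
    (hM : σ.tail ≤ M) :
    k * (M - ((σ.expand k N s).advance k).head) - ((σ.expand k N s).advance k).digit + 1 ≤
      k * (M - σ.head) - σ.digit := by
  have hd := h.digit_lt
  obtain ⟨r, hr⟩ := Nat.exists_eq_add_of_le (show σ.head + 1 ≤ M by omega)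
  have h1 : M - σ.head = r + 1 := by omega
  have h2 : M - (σ.head + 1) = r := by omega
  unfold SearchState.advance
  rw [expand_digit, expand_head]
  split_ifs
  · simp only [h1, mul_add]; omega
  · simp only [h1, h2, mul_add]; omega

/-- With the queue exhausted, marked codes are closed under allowed edges. Removing two digits of B
at a time would lead from a fitting code to a marked accepting one, against the answer 0. -/
theorem Inv.not_codeFits (h : Inv k N s H G σ) (hN : 0 < N) (he : σ.head = σ.tail)
    (h0 : σ.ans = 0) (n : ℕ) : ∀ j, 0 < j → j < σ.tail → ¬ CodeFits k N s 0 n (σ.queue j) := by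
  induction n using Nat.twoStepInduction with
  | zero => exact fun j hj hlt hf => h.not_accepting h0 j hj hlt (Or.inl hf)
  | one => exact fun j hj hlt hf => h.not_accepting h0 j hj hlt (Or.inr hf)
  | more n ih _ =>
    intro j hj hlt hf
    obtain ⟨b, hab, hf⟩ := (codeFits_step (by omega) hN).1 hf
    have := h.closed j b (Or.inl (he ▸ hlt)) (by rwa [show 1 - j = 0 by omega])
    obtain ⟨i, hi0, hi, hiq⟩ := h.exists_of_mark _ this
    exact ih i hi0 hi (hiq ▸ hf)

/-- If the search ends with the answer `0`, the initial pair is not good. -/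
theorem Inv.not_fits (h : Inv k N s H G σ) (hN : 0 < N) (he : σ.head = σ.tail)
    (h0 : σ.ans = 0) (h1 : ¬ Fits k N s 1 1 0 N) (n : ℕ) : ¬ Fits k N s 1 (n + 1) 0 N := by
  rcases n with _ | n
  -- A one-digit B has its own test, since `Accepting` does not require nonzero leading digits.
  · exact h1
  · intro hf
    have hf' : CodeFits k N s 1 (n + 2) (N * N) := by
      rwa [CodeFits, Nat.mul_mod_left, Nat.mul_div_cancel _ hN]
    obtain ⟨b, hab, hf'⟩ := (codeFits_step le_rfl hN).1 hf'
    have := h.closed 0 b (Or.inl (he ▸ h.tail_pos)) (by rwa [h.queue_zero])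
    obtain ⟨i, hi0, hi, hiq⟩ := h.exists_of_mark _ this
    rw [h.queue_zero] at hiq
    exact h.not_codeFits hN he h0 n i hi0 hi (hiq ▸ hf')

/-- The state at the beginning of the search. -/
theorem Inv.init {mark queue : ℕ → ℕ} {ans : ℕ} (hk : 0 < k) (hN : 0 < N)
    (hmark : ∀ q, mark q < k ^ s) (hqueue : queue 0 = N * N) (hans : ans ≤ 1)
    (h1 : ans = 1 → G) (h0 : ans = 0 → H) (hG : ∀ n, Fits k N s 1 (n + 1) 0 N → G) :
    Inv k N s H G ⟨mark, queue, 0, 1, 0, ans⟩ where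
  digit_lt := hk
  head_le := zero_le_one
  digit_eq := by simp
  queue_zero := hqueue
  tail_pos := one_pos
  queue_lt := fun j h h' => by simp only at h'; omega
  -- Old entries of the table lie below k ^ s and therefore count as unmarked.
  exists_of_mark := fun q h => absurd h (hmark q).ne
  mark_le := fun q => (hmark q).le
  tail_eq := by
    rw [Finset.filter_false_of_mem fun q _ => (hmark q).ne]; rfl
  ans_le := hans
  of_ans := h1
  of_ans_zero := h0
  sound := fun j hj n h => by
    obtain rfl : j = 0 := by simp only at hj; omega
    simp only [hqueue] at h
    rw [CodeFits, Nat.mul_mod_left, Nat.mul_div_cancel _ hN] at h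
    exact hG n h
  not_accepting := fun _ j h h' => by simp only at h'; omega
  closed := fun j b h => by
    rcases h with h | ⟨-, h⟩ <;> exact absurd h (Nat.not_lt_zero _)

end SearchState

/-! ### The machine test for antipalindromic strings -/

namespace RAM

/-- Reverse the digits of `r[12]` into `r[14]`, where `r[13] = k ^ s - 1` counts the digits. -/
def revLoop : Cmd :=
  .loop 13 (.block [.mod 15 12 0, .mul 14 14 0, .add 14 14 15, .div 12 12 0, .div 13 13 0])

/-- Set the answer register to `1` if `r[10]` is antipalindromic as a string of `s` digits, where
`r[11] = k ^ s - 1`. -/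
def checkCmd : Cmd :=
  .seq (.block [.const 14 0, .copy 12 10, .copy 13 11])
    (.seq revLoop
      (.seq (.block [.add 15 10 14, .sub 16 15 11, .sub 17 11 15, .add 16 16 17])
        (.ifZero 16 (.block [.const 3 1]) (.block []))))

theorem digitRev_lt {k : ℕ} (hk : 0 < k) (s x : ℕ) : digitRev k s x < k ^ s := by
  induction s generalizing x with
  | zero => simp [digitRev]
  | succ s ih =>
    have h1 := ih (x / k)
    have h2 := Nat.mod_lt x hk
    have h3 := Nat.mul_le_mul_right (k ^ s) (show x % k + 1 ≤ k by omega)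
    rw [digitRev, pow_succ']
    rw [add_mul] at h3
    omega

/-- This lets k ^ i - 1 serve as a counter of i digits: division by k removes one, and zero is
reached exactly at i = 0. -/
theorem pow_sub_one_div {k : ℕ} (hk : 2 ≤ k) (i : ℕ) : (k ^ (i + 1) - 1) / k = k ^ i - 1 := by
  have : 0 < k ^ i := by positivity
  rw [pow_succ']
  obtain ⟨j, hj⟩ := Nat.exists_eq_succ_of_ne_zero this.ne'
  rw [hj]
  have : k * (j + 1) - 1 = (k - 1) + k * j := by rw [mul_add]; omega
  rw [Nat.succ_eq_add_one, this, Nat.add_mul_div_left _ _ (by omega),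
    Nat.div_eq_of_lt (by omega)]
  omega

theorem revLoop_term {W k s X : ℕ} {m : Mem} (hk : 2 ≤ k) (hs : k ^ s ≤ W) (hX : X ≤ W)
    (hkW : k ≤ W) (h0 : m 0 = k) (h12 : m 12 = X) (h13 : m 13 = k ^ s - 1) (h14 : m 14 = 0) :
    Term W revLoop m (7 * s + 1) fun m' => m' 14 = digitRev k s X ∧
      ∀ r, r < 12 ∨ 18 ≤ r → m' r = m r := by
  have hp : ∀ i, k ^ i - 1 + 1 = k ^ i := fun i =>
    Nat.sub_add_cancel (Nat.one_le_pow _ _ (by omega))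
  have hlt := digitRev_lt (show 0 < k by omega) s X
  refine (Term.loop (Q := fun m' => m' 14 = digitRev k s X ∧ ∀ r, r < 12 ∨ 18 ≤ r → m' r = m r)
    (fun m' => (∀ r, r < 12 ∨ 18 ≤ r → m' r = m r) ∧ m' 12 ≤ X ∧
      ∃ i ≤ s, m' 13 = k ^ i - 1 ∧ digitRev k s X = m' 14 * k ^ i + digitRev k i (m' 12))
    -- Five instructions and two jumps per digit; the logarithm recovers the number of digits left.
    (fun m' => 7 * Nat.log k (m' 13 + 1)) ?_ ?_ ⟨fun _ _ => rfl, h12.le, s, le_rfl, h13, ?_⟩).mono ?_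
    fun _ h => h
  · rintro m' ⟨hf, h12', i, his, h13', hr⟩ hne
    rcases i with _ | i
    · simp [h13'] at hne
    have hφ : Nat.log k (m' 13 + 1) = i + 1 := by
      rw [h13', hp, Nat.log_pow (show 1 < k by omega)]
    refine ⟨5, by simp only [hφ]; omega, (Term.block ?_).mono le_rfl fun _ h => h⟩
    have hk0 : m' 0 = k := by rw [hf 0 (by omega), h0]
    rw [digitRev] at hr
    have hmod := Nat.mod_lt (m' 12) (show 0 < k by omega)
    have hdiv := Nat.div_le_self (m' 12) k
    have hr' : digitRev k s X = (m' 14 * k + m' 12 % k) * k ^ i + digitRev k i (m' 12 / k) := by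
      rw [hr]; ring
    -- The partial reversal is bounded by the complete one, which is below k ^ s ≤ W.
    have hle : m' 14 * k + m' 12 % k ≤ (m' 14 * k + m' 12 % k) * k ^ i :=
      Nat.le_mul_of_pos_right _ (by positivity)
    have hdiv13 : m' 13 / k = k ^ i - 1 := by rw [h13', pow_sub_one_div hk]
    have hiW := Nat.div_le_self (m' 13) k
    have hsW : k ^ i - 1 ≤ W := by
      have h2 : k ^ i ≤ k ^ s := Nat.pow_le_pow_right (by omega) (by omega)
      omega
    simp [BlockSpec, Instr.effect, Function.update_apply, hk0, hφ, hp,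
      Nat.log_pow (show 1 < k by omega), hdiv13]
    refine ⟨by omega, by omega, by omega, by omega, by omega, ⟨fun r hr => ?_, by omega,
      i, by omega, rfl, hr'⟩, by omega⟩
    rw [if_neg (by omega), if_neg (by omega), if_neg (by omega), if_neg (by omega),
      if_neg (by omega), hf r hr]
  · rintro m' ⟨hf, h12', i, his, h13', hr⟩ hz
    have hi : i = 0 := by
      by_contra hi
      have := Nat.one_lt_pow hi (show 1 < k by omega)
      omega
    subst hi
    exact ⟨by simpa [digitRev] using hr.symm, hf⟩
  · simp [h12, h14]
  · simp only [h13, hp, Nat.log_pow (show 1 < k by omega)]; omega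

open Classical in
theorem checkCmd_term {W k s X : ℕ} {m : Mem} (hk : 2 ≤ k) (hs : k ^ s ≤ W) (hX : X + k ^ s ≤ W)
    (hkW : k ≤ W) (h0 : m 0 = k) (h10 : m 10 = X) (h11 : m 11 = k ^ s - 1) :
    Term W checkCmd m (7 * s + 11) fun m' => m' 3 = (if IsAPString k s X then 1 else m 3) ∧
      ∀ r, r ≠ 3 → r < 12 ∨ 18 ≤ r → m' r = m r := by
  have hlt := digitRev_lt (show 0 < k by omega) s X
  have hT : 7 * s + 11 = 3 + (7 * s + 1 + (4 + (1 + 2))) := by ring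
  rw [hT]
  refine Term.seq ((Term.block (Q := fun m' => (∀ r, r < 12 ∨ 18 ≤ r → m' r = m r) ∧ m' 12 = X ∧
    m' 13 = k ^ s - 1 ∧ m' 14 = 0) ?_).mono le_rfl ?_)
  · simp [BlockSpec, Instr.effect, Function.update_apply, h10, h11]
    refine ⟨by omega, by omega, fun r hr => ?_⟩
    rw [if_neg (by omega), if_neg (by omega), if_neg (by omega)]
  · rintro m1 ⟨hf1, h12, h13, h14⟩
    refine Term.seq ((revLoop_term hk hs (by omega) hkW (by rw [hf1 0 (by omega), h0]) h12 h13
      h14).mono le_rfl ?_)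
    rintro m2 ⟨hR, hf2⟩
    have hf : ∀ r, r < 12 ∨ 18 ≤ r → m2 r = m r := fun r hr => by rw [hf2 r hr, hf1 r hr]
    -- Register 16 is the sum of both truncated differences, so it vanishes exactly at equality.
    refine Term.seq ((Term.block (Q := fun m' => (∀ r, r < 12 ∨ 18 ≤ r → m' r = m r) ∧
      (m' 16 = 0 ↔ IsAPString k s X)) ?_).mono le_rfl ?_)
    · simp [BlockSpec, Instr.effect, Function.update_apply, hf 10 (by omega), hf 11 (by omega),
        h10, h11, hR, IsAPString]
      refine ⟨by omega, by omega, by omega, by omega, fun r hr => ?_, by omega⟩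
      rw [if_neg (by omega), if_neg (by omega), if_neg (by omega), if_neg (by omega), hf r hr]
    · rintro m3 ⟨hf3, h16⟩
      refine Term.ifZero (fun hz => (Term.block ?_).mono le_rfl fun _ h => h)
        (fun hz => (Term.block ?_).mono (Nat.zero_le _) fun _ h => h)
      · simp [BlockSpec, Instr.effect, Function.update_apply, if_pos (h16.1 hz)]
        refine ⟨by omega, fun r hr hr' => ?_⟩
        rw [if_neg hr, hf3 r hr']
      · simp [BlockSpec, if_neg (mt h16.2 hz)]
        exact ⟨hf3 3 (by omega), fun r _ hr => hf3 r hr⟩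

open Classical in
-- In the applications X is a truncated difference, and A includes the inequality that makes it the
-- true one.
theorem guardedCheck_term {W k s X : ℕ} {A : Prop} {m : Mem} (hk : 2 ≤ k) (hs : k ^ s ≤ W)
    (hX : X + k ^ s ≤ W) (hkW : k ≤ W) (h0 : m 0 = k) (h10 : m 10 = X) (h11 : m 11 = k ^ s - 1)
    (h12 : m 12 = 0 ↔ A) :
    Term W (.ifZero 12 checkCmd (.block [])) m (7 * s + 13) fun m' =>
      m' 3 = (if A ∧ IsAPString k s X then 1 else m 3) ∧
      ∀ r, r ≠ 3 → r < 12 ∨ 18 ≤ r → m' r = m r := by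
  refine Term.ifZero (fun hz => ?_)
    (fun hz => (Term.block ?_).mono (Nat.zero_le _) fun _ h => h)
  · simpa only [h12.1 hz, true_and] using checkCmd_term hk hs hX hkW h0 h10 h11
  · exact ⟨(if_neg fun h => hz (h12.2 h.1)).symm, fun _ _ _ => rfl⟩

/-! ### Memory layout and the machine form of one search -/

/-- The memory `m` holds the state `σ` of the search. -/
structure Repr (k N s : ℕ) (σ : SearchState) (m : Mem) : Prop where
  base : m 0 = k
  factor : m 1 = N
  power : m 2 = k ^ s
  ans : m 3 = σ.ans
  head : m 4 = σ.head
  tail : m 5 = σ.tail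
  digit : m 6 = σ.digit
  mark : ∀ i, m (32 + 2 * i) = σ.mark i
  queue : ∀ i, m (33 + 2 * i) = σ.queue i

theorem Repr.of_eq {k N s a : ℕ} {σ : SearchState} {m m' : Mem} (h : Repr k N s σ m)
    (h3 : m' 3 = a) (hf : ∀ r, r ≠ 3 → r < 7 ∨ 32 ≤ r → m' r = m r) :
    Repr k N s { σ with ans := a } m' where
  base := by rw [hf 0 (by omega) (by omega), h.base]
  factor := by rw [hf 1 (by omega) (by omega), h.factor]
  power := by rw [hf 2 (by omega) (by omega), h.power]
  ans := h3
  head := by rw [hf 4 (by omega) (by omega), h.head]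
  tail := by rw [hf 5 (by omega) (by omega), h.tail]
  digit := by rw [hf 6 (by omega) (by omega), h.digit]
  mark := fun i => by rw [hf _ (by omega) (by omega), h.mark]
  queue := fun i => by rw [hf _ (by omega) (by omega), h.queue]

theorem Repr.of_frame {k N s : ℕ} {σ : SearchState} {m m' : Mem} (h : Repr k N s σ m)
    (hf : ∀ r, r < 7 ∨ 32 ≤ r → m' r = m r) : Repr k N s σ m' := by
  have := h.of_eq (m' := m') (a := σ.ans) (by rw [hf 3 (by omega), h.ans]) fun r _ hr => hf r hr
  exact this

/-- The quantities that occur in a search are bounded by `V`, and those computed from them by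
`W`. -/
structure Small (k N s V W : ℕ) : Prop where
  two_le : 2 ≤ k
  pos : 0 < N
  base_le : k ≤ V
  pow_le : k ^ (s + 1) ≤ V
  size_le : N * (N + k ^ s) + 1 ≤ V
  le_word : 10 * (V * V) + 100 ≤ W

namespace Small

variable {k N s V W : ℕ}

theorem le_mul (h : Small k N s V W) : V ≤ V * V :=
  Nat.le_mul_of_pos_left _ (lt_of_lt_of_le (Nat.succ_pos _) h.size_le)

theorem add_le (h : Small k N s V W) : N + k ^ s ≤ V := by
  have := Nat.le_mul_of_pos_left (N + k ^ s) h.pos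
  have := h.size_le
  omega

theorem mul_le (_ : Small k N s V W) {x y : ℕ} (hx : x ≤ V) (hy : y ≤ V) : x * y ≤ V * V :=
  Nat.mul_le_mul hx hy

end Small

/-- Test whether a pair admits an inner part of no digits. -/
def evenTest : Cmd :=
  .seq (.block [.add 10 9 8, .sub 12 1 10, .sub 10 10 1, .const 19 1, .sub 11 2 19])
    (.ifZero 12 checkCmd (.block []))

/-- Prepare the test for an inner part of one digit: the middle digit of `B` is `k / 2`. -/
def oddPrep : List Instr :=
  [.const 19 1, .const 16 2, .mod 12 0 16, .sub 12 19 12, .div 10 0 16, .mul 10 1 10]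

/-- Test whether a pair admits an inner part of one digit. -/
def oddTest : Cmd :=
  .seq (.block oddPrep) (.seq (.block [.mul 13 0 9, .add 10 13 10, .add 10 10 8, .mul 13 0 1,
      .sub 14 13 10, .add 12 12 14, .sub 10 10 13, .mul 11 0 2, .sub 11 11 19])
    (.ifZero 12 checkCmd (.block [])))

theorem oddPrep_term {k N s V W : ℕ} {m : Mem} (hS : Small k N s V W) (h0 : m 0 = k)
    (h1 : m 1 = N) : Term W (.block oddPrep) m 6 fun m' =>
      (∀ r, r < 10 ∨ 20 ≤ r → m' r = m r) ∧ m' 10 = N * (k / 2) ∧ m' 12 = 1 - k % 2 ∧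
        m' 19 = 1 := by
  have hV := hS.le_mul
  have hW := hS.le_word
  have hk := hS.base_le
  have hN := hS.add_le
  have e1 := hS.mul_le (show N ≤ V by omega) (show k / 2 ≤ V by omega)
  refine (Term.block ?_).mono le_rfl fun _ h => h
  simp [oddPrep, BlockSpec, Instr.effect, Function.update_apply, h0, h1]
  refine ⟨by omega, by omega, by omega, by omega, by omega, by omega, fun r hr => ?_⟩
  iterate 6 rw [if_neg (by omega)]

open Classical in
theorem evenTest_term {k N s V W q : ℕ} {σ : SearchState} {m : Mem} (hS : Small k N s V W)
    (hm : Repr k N s σ m) (h8 : m 8 = q % N) (h9 : m 9 = q / N) (hq : q ≤ V) :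
    Term W evenTest m (7 * s + 18) fun m' => m' 8 = m 8 ∧ m' 9 = m 9 ∧
      Repr k N s { σ with ans := if CodeFits k N s 0 0 q then 1 else σ.ans } m' := by
  have h1 := hS.le_mul
  have h2 := hS.le_word
  have h3 := hS.add_le
  have h4 := hS.base_le
  have h5 := Nat.mod_le q N
  have h6 := Nat.div_le_self q N
  have hT : 7 * s + 18 = 5 + (7 * s + 13) := by ring
  rw [hT]
  refine Term.seq ((Term.block (Q := fun m' => (∀ r, r < 10 ∨ 20 ≤ r → m' r = m r) ∧
    m' 10 = q / N + q % N - N ∧ m' 11 = k ^ s - 1 ∧ (m' 12 = 0 ↔ N ≤ q / N + q % N)) ?_).mono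
    le_rfl ?_)
  · simp [BlockSpec, Instr.effect, Function.update_apply, h8, h9, hm.factor, hm.power,
      Nat.sub_eq_zero_iff_le]
    refine ⟨by omega, by omega, by omega, by omega, by omega, fun r hr => ?_⟩
    rw [if_neg (by omega), if_neg (by omega), if_neg (by omega), if_neg (by omega),
      if_neg (by omega)]
  · rintro m1 ⟨hf, h10, h11, h12⟩
    refine (guardedCheck_term hS.two_le (by omega) (by omega) (by omega)
      (by rw [hf 0 (by omega), hm.base]) h10 h11 h12).mono le_rfl ?_
    rintro m2 ⟨h23, hf2⟩
    have hf' : ∀ r, r ≠ 3 → r < 10 ∨ 20 ≤ r → m2 r = m r := fun r hr hr' => by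
      rw [hf2 r hr (by omega), hf r hr']
    refine ⟨hf' 8 (by omega) (by omega), hf' 9 (by omega) (by omega),
      hm.of_eq ?_ fun r hr hr' => hf' r hr (by omega)⟩
    rw [h23, hf 3 (by omega), hm.ans]
    convert rfl using 2
    exact fits_zero

open Classical in
theorem oddTest_term {k N s V W q : ℕ} {σ : SearchState} {m : Mem} (hS : Small k N s V W)
    (hm : Repr k N s σ m) (h8 : m 8 = q % N) (h9 : m 9 = q / N) (hq : q ≤ V) :
    Term W oddTest m (7 * s + 35) fun m' =>
      Repr k N s { σ with ans := if CodeFits k N s 0 1 q then 1 else σ.ans } m' := by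
  have h1 := hS.le_mul
  have h2 := hS.le_word
  have h3 := hS.add_le
  have h4 := hS.base_le
  have h5 := Nat.mod_le q N
  have h6 := Nat.div_le_self q N
  have h7 := Nat.div_le_self k 2
  have hp := hS.pow_le
  have hp' : k * k ^ s = k ^ (s + 1) := (pow_succ' _ _).symm
  have e1 := hS.mul_le (show N ≤ V by omega) (show k / 2 ≤ V by omega)
  have e2 := hS.mul_le h4 (show q / N ≤ V by omega)
  have e3 := hS.mul_le h4 (show N ≤ V by omega)
  -- The middle digit of B leaves A with s + 1 digits to check.
  have hT : 7 * s + 35 = 6 + (9 + (7 * (s + 1) + 13)) := by ring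
  rw [hT]
  refine Term.seq ((oddPrep_term hS hm.base hm.factor).mono le_rfl ?_)
  rintro m0 ⟨hf0, h10, h12, h19⟩
  refine Term.seq ((Term.block (Q := fun m' => (∀ r, r < 10 ∨ 20 ≤ r → m' r = m r) ∧
    m' 10 = k * (q / N) + N * (k / 2) + q % N - k * N ∧ m' 11 = k ^ (s + 1) - 1 ∧
    (m' 12 = 0 ↔ k % 2 = 1 ∧ k * N + 0 * k ^ s ≤ k * (q / N) + N * (k / 2) + q % N)) ?_).mono
    le_rfl ?_)
  · simp [BlockSpec, Instr.effect, Function.update_apply, hf0 8, hf0 9, hf0 0, hf0 1, hf0 2,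
      h8, h9, h10, h12, h19, hm.factor, hm.power, hm.base, Nat.sub_eq_zero_iff_le, hp']
    refine ⟨by omega, by omega, by omega, by omega, by omega, by omega, by omega, by omega,
      by omega, fun r hr => ?_, by omega⟩
    iterate 9 rw [if_neg (by omega)]
    exact hf0 r hr
  · rintro m1 ⟨hf, h10, h11, h12⟩
    refine (guardedCheck_term hS.two_le (by omega) (by omega) (by omega)
      (by rw [hf 0 (by omega), hm.base]) h10 h11 h12).mono le_rfl ?_
    rintro m2 ⟨h23, hf2⟩
    refine hm.of_eq ?_ fun r hr hr' => by rw [hf2 r hr (by omega), hf r (by omega)]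
    rw [h23, hf 3 (by omega), hm.ans]
    convert rfl using 2
    rw [CodeFits, fits_one hS.two_le (by omega), and_assoc]

/-- Test whether the pair in the registers `8` and `9` is accepting. -/
def testCmd : Cmd := .seq evenTest oddTest

theorem testCmd_term {k N s V W q : ℕ} {σ : SearchState} {m : Mem} (hS : Small k N s V W)
    (hm : Repr k N s σ m) (h8 : m 8 = q % N) (h9 : m 9 = q / N) (hq : q ≤ V) :
    Term W testCmd m (14 * s + 53) (Repr k N s (σ.test k N s q)) := by
  classical
  have hT : 14 * s + 53 = (7 * s + 18) + (7 * s + 35) := by ring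
  rw [hT]
  refine Term.seq ((evenTest_term hS hm h8 h9 hq).mono le_rfl ?_)
  rintro m1 ⟨h8', h9', hm1⟩
  refine (oddTest_term hS hm1 (h8'.trans h8) (h9'.trans h9) hq).mono le_rfl fun m2 h => ?_
  convert h using 1
  simp only [SearchState.test, Accepting]
  by_cases ha : CodeFits k N s 0 0 q <;> by_cases hb : CodeFits k N s 0 1 q <;> simp [ha, hb]

/-- Decode the pair in the head of the queue. -/
def decodeCmd : List Instr :=
  [.const 16 2, .const 18 33, .mul 20 16 4, .add 20 20 18, .load 20 20, .mod 8 20 1, .div 9 20 1]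

/-- Compute the next carry. -/
def carryCmd : List Instr := [.mul 21 1 6, .add 25 21 8, .mod 22 25 0, .div 8 25 0]

/-- Compute the next excess. -/
def excessCmd : List Instr :=
  [.const 19 1, .sub 24 0 19, .sub 24 24 22, .mul 24 24 2, .add 24 21 24, .mul 26 0 9,
    .sub 9 26 24]

/-- Test whether the digits may be chosen. -/
def digitGuardCmd : List Instr :=
  [.sub 23 19 4, .add 27 6 23, .add 27 27 19, .sub 27 27 0, .add 28 22 23, .add 28 28 19,
    .sub 28 28 0, .add 27 27 28]

/-- Test whether the excess is within the bounds. -/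
def excessGuardCmd : List Instr :=
  [.sub 28 19 9, .add 27 27 28, .add 28 1 2, .add 29 9 19, .sub 29 29 28, .add 27 27 29]

/-- Compute the successor of the pair in the head of the queue for the current digit, and the
condition that it is allowed. -/
def transCmd : Cmd :=
  .seq (.block decodeCmd) (.seq (.block carryCmd) (.seq (.block excessCmd)
    (.seq (.block digitGuardCmd) (.block excessGuardCmd))))

set_option maxHeartbeats 1000000 in
theorem transCmd_term {k N s V W : ℕ} {σ : SearchState} {m : Mem} (hS : Small k N s V W)
    (hm : Repr k N s σ m) (hd : σ.digit < k) (hh : σ.head ≤ V) (hq : σ.queue σ.head ≤ V) :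
    Term W transCmd m 32 fun m' => Repr k N s σ m' ∧
      m' 8 = nextCarry k N (σ.queue σ.head % N) σ.digit ∧
      m' 9 = nextExcess k N (k ^ s) (σ.queue σ.head % N) (σ.queue σ.head / N) σ.digit ∧
      (m' 27 = 0 ↔ CodeAllowed k N (k ^ s) (1 - σ.head) (σ.queue σ.head) σ.digit) := by
  have h1 := hS.le_mul
  have h2 := hS.le_word
  have h3 := hS.add_le
  have h4 := hS.base_le
  have hk := hS.two_le
  have hqueue := hm.queue σ.head
  rw [add_comm 33] at hqueue
  generalize σ.queue σ.head = q at *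
  have h5 := Nat.mod_le q N
  have h6 := Nat.div_le_self q N
  have e1 := hS.mul_le (show N ≤ V by omega) (show σ.digit ≤ V by omega)
  have e2 := hS.mul_le h4 (show q / N ≤ V by omega)
  have h7 := Nat.mod_lt (N * σ.digit + q % N) (show 0 < k by omega)
  have h8 := Nat.div_le_self (N * σ.digit + q % N) k
  refine Term.seq (S := 7) (T := 25) ((Term.block (Q := fun m' =>
    (∀ r, r < 8 ∨ 30 ≤ r → m' r = m r) ∧ m' 8 = q % N ∧ m' 9 = q / N) ?_).mono le_rfl ?_)
  · simp [decodeCmd, BlockSpec, Instr.effect, Function.update_apply, hm.factor, hm.head, hqueue]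
    refine ⟨by omega, by omega, by omega, by omega, by omega, by omega, by omega, fun r hr => ?_⟩
    iterate 7 rw [if_neg (by omega)]
  rintro m1 ⟨hf1, a8, a9⟩
  refine Term.seq (S := 4) (T := 21) ((Term.block (Q := fun m' =>
    (∀ r, r < 8 ∨ 30 ≤ r → m' r = m r) ∧ m' 8 = nextCarry k N (q % N) σ.digit ∧ m' 9 = q / N ∧
      m' 21 = N * σ.digit ∧ m' 22 = outDigit k N (q % N) σ.digit) ?_).mono le_rfl ?_)
  · simp [carryCmd, BlockSpec, Instr.effect, Function.update_apply, hf1 0, hf1 1, hf1 6, a8, a9,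
      hm.base, hm.factor, hm.digit, nextCarry, outDigit]
    refine ⟨by omega, by omega, by omega, by omega, fun r hr => ?_⟩
    iterate 4 rw [if_neg (by omega)]
    exact hf1 r hr
  rintro m2 ⟨hf2, b8, b9, b21, b22⟩
  have h9 : outDigit k N (q % N) σ.digit < k := h7
  have h10 : nextCarry k N (q % N) σ.digit ≤ N * σ.digit + q % N := h8
  generalize hx : nextExcess k N (k ^ s) (q % N) (q / N) σ.digit = x
  have hx' : x ≤ V * V := by rw [← hx, nextExcess]; omega
  have e3 : (k - 1 - outDigit k N (q % N) σ.digit) * k ^ s ≤ V * V :=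
    hS.mul_le (by omega) (by omega)
  refine Term.seq (S := 7) (T := 14) ((Term.block (Q := fun m' =>
    (∀ r, r < 8 ∨ 30 ≤ r → m' r = m r) ∧ m' 8 = nextCarry k N (q % N) σ.digit ∧ m' 9 = x ∧
      m' 19 = 1 ∧ m' 22 = outDigit k N (q % N) σ.digit) ?_).mono le_rfl ?_)
  · rw [nextExcess] at hx
    simp [excessCmd, BlockSpec, Instr.effect, Function.update_apply, hf2 0, hf2 2, b8, b9,
      b21, b22, hm.base, hm.power, hx]
    refine ⟨by omega, by omega, by omega, by omega, by omega, by omega, by omega, fun r hr => ?_⟩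
    iterate 7 rw [if_neg (by omega)]
    exact hf2 r hr
  rintro m3 ⟨hf3, c8, c9, c19, c22⟩
  -- Register 27 accumulates truncated differences, each zero exactly when its inequality holds; it
  -- ends at zero exactly when all conditions hold.
  refine Term.seq (S := 8) (T := 6) ((Term.block (Q := fun m' =>
    (∀ r, r < 8 ∨ 30 ≤ r → m' r = m r) ∧ m' 8 = nextCarry k N (q % N) σ.digit ∧ m' 9 = x ∧
      m' 19 = 1 ∧ m' 27 = (σ.digit + (1 - σ.head) + 1 - k) +
        (outDigit k N (q % N) σ.digit + (1 - σ.head) + 1 - k)) ?_).mono le_rfl ?_)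
  · simp [digitGuardCmd, BlockSpec, Instr.effect, Function.update_apply, hf3 0, hf3 4, hf3 6, c8,
      c9, c19, c22, hm.base, hm.head, hm.digit]
    refine ⟨by omega, by omega, by omega, by omega, by omega, by omega, by omega, by omega,
      fun r hr => ?_⟩
    iterate 8 rw [if_neg (by omega)]
    exact hf3 r hr
  rintro m4 ⟨hf4, d8, d9, d19, d27⟩
  refine (Term.block (Q := fun m' => (∀ r, r < 8 ∨ 30 ≤ r → m' r = m r) ∧
      m' 8 = nextCarry k N (q % N) σ.digit ∧ m' 9 = x ∧
      (m' 27 = 0 ↔ CodeAllowed k N (k ^ s) (1 - σ.head) q σ.digit)) ?_).mono le_rfl ?_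
  · rw [CodeAllowed, Allowed, hx]
    simp [excessGuardCmd, BlockSpec, Instr.effect, Function.update_apply, hf4 1, hf4 2, d8, d9,
      d19, d27, hm.factor, hm.power]
    refine ⟨by omega, by omega, by omega, by omega, by omega, by omega, fun r hr => ?_, by omega⟩
    iterate 6 rw [if_neg (by omega)]
    exact hf4 r hr
  · rintro m' ⟨hf, h⟩
    exact ⟨hm.of_frame fun r hr => hf r (by omega), h⟩

/-- From address 32 on, marks occupy the even cells and the queue the odd ones, so both tables grow
without a bound fixed in advance. -/
theorem ne_markAddress (a i : ℕ) (h : a < 32) : a ≠ 32 + 2 * i := by omega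

theorem markAddress_ne (a i : ℕ) (h : a < 32) : 32 + 2 * i ≠ a := by omega

theorem ne_queueAddress (a i : ℕ) (h : a < 32) : a ≠ 33 + 2 * i := by omega

theorem queueAddress_ne (a i : ℕ) (h : a < 32) : 33 + 2 * i ≠ a := by omega

theorem markAddress_ne_queueAddress (i j : ℕ) : 32 + 2 * i ≠ 33 + 2 * j := by omega

theorem queueAddress_ne_markAddress (i j : ℕ) : 33 + 2 * i ≠ 32 + 2 * j := by omega

/-- Look up the mark of the new code. -/
def lookupCmd : List Instr :=
  [.const 16 2, .const 17 32, .mul 30 1 9, .add 30 30 8, .mul 20 16 30, .add 20 20 17,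
    .load 28 20, .sub 28 2 28]

/-- Mark the new code and put it into the queue. -/
def pushCmd : List Instr :=
  [.const 16 2, .const 18 33, .const 19 1, .store 20 2, .mul 20 16 5, .add 20 20 18,
    .store 20 30, .add 5 5 19]

/-- Follow the transition for the current digit. -/
def expandCmd : Cmd :=
  .seq transCmd (.ifZero 27 (.seq (.block lookupCmd)
    (.ifZero 28 (.block []) (.seq (.block pushCmd) testCmd))) (.block []))

theorem pushCmd_term {k N s V W q : ℕ} {σ : SearchState} {m : Mem} (hS : Small k N s V W)
    (hm : Repr k N s σ m) (ht : σ.tail ≤ V) (h20 : m 20 = 32 + 2 * q) (h30 : m 30 = q)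
    (hq : q ≤ V) : Term W (.block pushCmd) m 8 fun m' => m' 8 = m 8 ∧ m' 9 = m 9 ∧
      Repr k N s (σ.push (k ^ s) q) m' := by
  have h1 := hS.le_mul
  have h2 := hS.le_word
  have h3 := hS.add_le
  refine (Term.block (Q := fun m' => (∀ r, r < 10 → r ≠ 5 → m' r = m r) ∧ m' 5 = σ.tail + 1 ∧
    (∀ i, m' (32 + 2 * i) = if i = q then k ^ s else m (32 + 2 * i)) ∧
    (∀ i, m' (33 + 2 * i) = if i = σ.tail then q else m (33 + 2 * i))) ?_).mono le_rfl ?_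
  · simp [pushCmd, BlockSpec, Instr.effect, Function.update_apply, h20, h30, hm.power, hm.tail,
      add_comm _ 33, ne_markAddress, markAddress_ne, ne_queueAddress, queueAddress_ne,
      markAddress_ne_queueAddress, queueAddress_ne_markAddress]
    refine ⟨by omega, by omega, by omega, by omega, by omega, by omega, by omega, by omega,
      fun r hr hr' => ?_⟩
    iterate 8 rw [if_neg (by omega)]
  · rintro m' ⟨hf, h5, hmark, hqueue⟩
    refine ⟨hf 8 (by omega) (by omega), hf 9 (by omega) (by omega), ?_⟩
    refine ⟨?_, ?_, ?_, ?_, ?_, h5, ?_, fun i => ?_, fun i => ?_⟩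
    · rw [hf 0 (by omega) (by omega), hm.base]
    · rw [hf 1 (by omega) (by omega), hm.factor]
    · rw [hf 2 (by omega) (by omega), hm.power]
    · rw [hf 3 (by omega) (by omega), hm.ans]; rfl
    · rw [hf 4 (by omega) (by omega), hm.head]; rfl
    · rw [hf 6 (by omega) (by omega), hm.digit]; rfl
    · rw [hmark, hm.mark]; exact (Function.update_apply _ _ _ _).symm
    · rw [hqueue, hm.queue]; exact (Function.update_apply _ _ _ _).symm

theorem expandCmd_term {k N s V W : ℕ} {σ : SearchState} {m : Mem} (hS : Small k N s V W)
    (hm : Repr k N s σ m) (hd : σ.digit < k) (hh : σ.head ≤ V) (hq : σ.queue σ.head ≤ V)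
    (ht : σ.tail ≤ V) (hmark : ∀ q, σ.mark q ≤ k ^ s) :
    Term W expandCmd m (14 * s + 105) (Repr k N s (σ.expand k N s)) := by
  have h1 := hS.le_mul
  have h2 := hS.le_word
  have h3 := hS.add_le
  have h4 := hS.size_le
  have hT : 14 * s + 105 = 32 + (8 + (8 + (14 * s + 53) + 2) + 2) := by ring
  rw [hT]
  refine Term.seq ((transCmd_term hS hm hd hh hq).mono le_rfl ?_)
  rintro m1 ⟨hm1, h8, h9, h27⟩
  have hmod : (σ.next k N s) % N = m1 8 := by
    rw [h8]; exact nextCode_mod hS.pos hd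
  have hdiv : (σ.next k N s) / N = m1 9 := by
    rw [h9]; exact nextCode_div hS.pos hd
  refine Term.ifZero (fun hz => ?_)
    (fun hz => (Term.block ?_).mono (Nat.zero_le _) fun _ h => h)
  · have ha := h27.1 hz
    -- Only the guard puts the code in range, which is why the table is consulted inside this
    -- branch.
    have hlt : σ.next k N s < N * (N + k ^ s) := nextCode_lt hS.pos ha
    have hcode : N * m1 9 + m1 8 = σ.next k N s := by
      rw [← hmod, ← hdiv]; exact Nat.div_add_mod _ _
    have hmk := hm1.mark (σ.next k N s)
    rw [add_comm 32] at hmk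
    have hmkle := hmark (σ.next k N s)
    refine Term.seq ((Term.block (Q := fun m' => (∀ r, r < 10 ∨ 32 ≤ r → m' r = m1 r) ∧
      m' 20 = 32 + 2 * σ.next k N s ∧ m' 30 = σ.next k N s ∧
      (m' 28 = 0 ↔ σ.mark (σ.next k N s) = k ^ s)) ?_).mono le_rfl ?_)
    · simp [lookupCmd, BlockSpec, Instr.effect, Function.update_apply, hm1.factor, hm1.power,
        hcode, hmk]
      refine ⟨by omega, by omega, by omega, by omega, by omega, by omega, by omega, by omega,
        fun r hr => ?_, by omega, by omega⟩
      iterate 8 rw [if_neg (by omega)]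
    · rintro m2 ⟨hf, h20, h30, h28⟩
      have hm2 : Repr k N s σ m2 := hm1.of_frame fun r hr => hf r (by omega)
      refine Term.ifZero (fun hz' => (Term.block ?_).mono (Nat.zero_le _) fun _ h => h)
        (fun hz' => ?_)
      · rw [SearchState.expand, if_neg fun h => h.2 (h28.1 hz')]
        exact hm2
      · rw [SearchState.expand, if_pos ⟨ha, fun h => hz' (h28.2 h)⟩]
        refine Term.seq ((pushCmd_term hS hm2 ht h20 h30 (by omega)).mono le_rfl ?_)
        rintro m3 ⟨h38, h39, hm3⟩
        exact testCmd_term hS hm3 (by rw [h38, hf 8 (by omega), hmod])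
          (by rw [h39, hf 9 (by omega), hdiv]) (by omega)
  · rw [SearchState.expand, if_neg fun h => hz (h27.2 h.1)]
    exact hm1

/-- Go on to the next digit, and compute the number of waiting codes. -/
def advanceCmd : Cmd :=
  .seq (.block [.const 19 1, .add 6 6 19, .sub 27 0 6])
    (.seq (.ifZero 27 (.block [.const 6 0, .add 4 4 19]) (.block [])) (.block [.sub 7 5 4]))

theorem advanceCmd_term {k N s V W : ℕ} {σ : SearchState} {m : Mem} (hS : Small k N s V W)
    (hm : Repr k N s σ m) (hd : σ.digit < k) (hh : σ.head ≤ V) (ht : σ.tail ≤ V) :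
    Term W advanceCmd m 8 fun m' => Repr k N s (σ.advance k) m' ∧
      m' 7 = (σ.advance k).tail - (σ.advance k).head := by
  have h1 := hS.le_mul
  have h2 := hS.le_word
  have h4 := hS.base_le
  refine Term.seq (S := 3) (T := 5) ((Term.block (Q := fun m' => Repr k N s
    { σ with digit := σ.digit + 1 } m' ∧ m' 19 = 1 ∧ m' 27 = k - (σ.digit + 1)) ?_).mono
    le_rfl ?_)
  · simp [BlockSpec, Instr.effect, hm.base, hm.digit]
    refine ⟨by omega, by omega, by omega, ?_⟩
    constructor <;> simp [markAddress_ne, queueAddress_ne, hm.base, hm.factor, hm.power, hm.ans, hm.head,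
      hm.tail, hm.mark, hm.queue]
  · rintro m1 ⟨hm1, h19, h27⟩
    refine Term.seq (S := 4) (T := 1) ((Term.ifZero (T := 2) (Q := Repr k N s (σ.advance k))
      (fun hz => (Term.block ?_).mono le_rfl fun _ h => h)
      (fun hz => (Term.block ?_).mono (Nat.zero_le _) fun _ h => h)).mono le_rfl ?_)
    · have hk : ¬ σ.digit + 1 < k := by omega
      simp [BlockSpec, Instr.effect, h19, hm1.head, SearchState.advance, hk]
      refine ⟨by omega, ?_⟩
      constructor <;> simp [markAddress_ne, queueAddress_ne, hm1.base, hm1.factor, hm1.power, hm1.ans,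
        hm1.tail, hm1.mark, hm1.queue]
    · have hk : σ.digit + 1 < k := by omega
      rw [SearchState.advance, if_pos hk]
      exact hm1
    · intro m2 hm2
      refine (Term.block (Q := fun m' => (∀ r, r ≠ 7 → m' r = m2 r) ∧
        m' 7 = (σ.advance k).tail - (σ.advance k).head) ?_).mono le_rfl ?_
      · have hle : (σ.advance k).tail ≤ V := by
          rw [SearchState.advance]; split_ifs <;> exact ht
        simp [BlockSpec, Instr.effect, Function.update_apply, hm2.tail, hm2.head]
        exact ⟨by omega, fun r hr h => absurd h hr⟩
      · rintro m3 ⟨hf, h7⟩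
        exact ⟨hm2.of_frame fun r hr => hf r (by omega), h7⟩

/-- The breadth first search. -/
def searchCmd : Cmd := .loop 7 (.seq expandCmd advanceCmd)

theorem searchCmd_term {k N s V W : ℕ} {H G : Prop} {σ : SearchState} {m : Mem}
    (hS : Small k N s V W) (hm : Repr k N s σ m) (hσ : SearchState.Inv k N s H G σ)
    (h7 : m 7 = σ.tail - σ.head) :
    Term W searchCmd m (k * (N * (N + k ^ s) + 1) * (14 * s + 115) + 1) fun m' =>
      ∃ σ', Repr k N s σ' m' ∧ SearchState.Inv k N s H G σ' ∧ σ'.head = σ'.tail := by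
  refine (Term.loop (Q := fun m' => ∃ σ', Repr k N s σ' m' ∧ SearchState.Inv k N s H G σ' ∧
      σ'.head = σ'.tail)
    (fun m' => ∃ σ, Repr k N s σ m' ∧ SearchState.Inv k N s H G σ ∧ m' 7 = σ.tail - σ.head)
    -- The first factor bounds the queue-digit pairs still to be treated; 115 = 105 + 8 + 2 covers
    -- expansion, advance and the two jumps.
    (fun m' => (k * (N * (N + k ^ s) + 1 - m' 4) - m' 6) * (14 * s + 115)) ?_ ?_
    ⟨σ, hm, hσ, h7⟩).mono ?_ fun _ h => h
  · rintro m1 ⟨σ, hm, hσ, h7⟩ hne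
    have hlt : σ.head < σ.tail := by omega
    have htail := hσ.tail_le
    have hsize := hS.size_le
    have hstep := hσ.step hS.pos hlt
    have hrem := hσ.remaining_step hlt (M := N * (N + k ^ s) + 1) (by omega)
    have hex := hσ.expand hS.pos hlt
    have hextail := hex.tail_le
    have hexd : (σ.expand k N s).digit < k := hex.digit_lt
    have hexh := hex.head_le
    have hmul := Nat.mul_le_mul_right (14 * s + 115) hrem
    rw [add_mul, one_mul] at hmul
    refine ⟨14 * s + 105 + 8, ?_, ?_⟩
    · simp only [hm.head, hm.digit]; omega
    · refine Term.seq ((expandCmd_term hS hm hσ.digit_lt (by omega)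
        ((hσ.queue_le hlt).trans (by omega)) (by omega) hσ.mark_le).mono le_rfl fun m2 hm2 => ?_)
      refine (advanceCmd_term hS hm2 hexd (by omega) (by omega)).mono le_rfl ?_
      rintro m3 ⟨hm3, h37⟩
      refine ⟨⟨_, hm3, hstep, h37⟩, ?_⟩
      simp only [hm.head, hm.digit, hm3.head, hm3.digit]
      omega
  · rintro m1 ⟨σ, hm, hσ, h7⟩ hz
    exact ⟨σ, hm, hσ, le_antisymm hσ.head_le (by omega)⟩
  · refine Nat.add_le_add_right (Nat.mul_le_mul_right _ ?_) 1
    exact (Nat.sub_le _ _).trans (Nat.mul_le_mul_left _ (Nat.sub_le _ _))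

/-- Test for an antipalindromic number `B` of one digit. -/
def startTest : Cmd :=
  .seq (.block oddPrep) (.seq (.block [.sub 14 2 10, .add 12 12 14, .mul 11 0 2, .sub 11 11 19])
    (.ifZero 12 checkCmd (.block [])))

open Classical in
theorem startTest_term {k N s V W : ℕ} {σ : SearchState} {m : Mem} (hS : Small k N s V W)
    (hm : Repr k N s σ m) :
    Term W startTest m (7 * s + 30) fun m' => m' 7 = m 7 ∧
      Repr k N s { σ with ans := if Fits k N s 1 1 0 N then 1 else σ.ans } m' := by
  have h1 := hS.le_mul
  have h2 := hS.le_word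
  have h3 := hS.add_le
  have h4 := hS.base_le
  have h7 := Nat.div_le_self k 2
  have hp := hS.pow_le
  have hp' : k * k ^ s = k ^ (s + 1) := (pow_succ' _ _).symm
  have e1 := hS.mul_le (show N ≤ V by omega) (show k / 2 ≤ V by omega)
  have hT : 7 * s + 30 = 6 + (4 + (7 * (s + 1) + 13)) := by ring
  rw [hT]
  refine Term.seq ((oddPrep_term hS hm.base hm.factor).mono le_rfl ?_)
  rintro m0 ⟨hf0, h10, h12, h19⟩
  refine Term.seq ((Term.block (Q := fun m' => (∀ r, r < 10 ∨ 20 ≤ r → m' r = m r) ∧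
    m' 10 = k * N + N * (k / 2) + 0 - k * N ∧ m' 11 = k ^ (s + 1) - 1 ∧
    -- With carry 0 and excess N the terms k * N cancel, so the program tests N * (k / 2) itself
    -- against k ^ s.
    (m' 12 = 0 ↔ k % 2 = 1 ∧ k * N + 1 * k ^ s ≤ k * N + N * (k / 2) + 0)) ?_).mono
    le_rfl ?_)
  · simp [BlockSpec, Instr.effect, Function.update_apply, hf0 0, hf0 2, h10, h12, h19, hm.power,
      hm.base, Nat.sub_eq_zero_iff_le, hp']
    refine ⟨by omega, by omega, by omega, by omega, fun r hr => ?_, by omega⟩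
    iterate 4 rw [if_neg (by omega)]
    exact hf0 r hr
  · rintro m1 ⟨hf, h10, h11, h12⟩
    refine (guardedCheck_term hS.two_le (by omega) (by omega) (by omega)
      (by rw [hf 0 (by omega), hm.base]) h10 h11 h12).mono le_rfl ?_
    rintro m2 ⟨h23, hf2⟩
    refine ⟨by rw [hf2 7 (by omega) (by omega), hf 7 (by omega)],
      hm.of_eq ?_ fun r hr hr' => by rw [hf2 r hr (by omega), hf r (by omega)]⟩
    rw [h23, hf 3 (by omega), hm.ans]
    convert rfl using 2
    rw [fits_one hS.two_le le_rfl, and_assoc]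

/-- Set up the search. -/
def setupCmd : List Instr :=
  [.const 4 0, .const 5 1, .const 6 0, .const 16 33, .mul 17 1 1, .store 16 17, .const 7 1]

/-- The complete search for the power of `k` in the register `2`. -/
def roundCmd : Cmd := .seq (.block setupCmd) (.seq startTest searchCmd)

/-- The memory between two searches. -/
structure Between (k N s : ℕ) (m : Mem) : Prop where
  base : m 0 = k
  factor : m 1 = N
  power : m 2 = k ^ s
  mark : ∀ i, m (32 + 2 * i) < k ^ s
  ans_le : m 3 ≤ 1
  of_ans : m 3 = 1 → IsAntipalindromicQuotient k N
  of_ans_zero : m 3 = 0 → ∀ s' < s, ∀ n, ¬ Fits k N s' 1 (n + 1) 0 N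

theorem roundCmd_term {k N s V W : ℕ} {m : Mem} (hS : Small k N s V W) (hs : k ^ s < k * N)
    (hm : Between k N s m) :
    Term W roundCmd m (k * (N * (N + k ^ s) + 1) * (14 * s + 115) + (7 * s + 38)) fun m' =>
      m' 0 = k ∧ m' 1 = N ∧ m' 2 = k ^ s ∧ (∀ i, m' (32 + 2 * i) ≤ k ^ s) ∧ m' 3 ≤ 1 ∧
      (m' 3 = 1 → IsAntipalindromicQuotient k N) ∧
      (m' 3 = 0 → ∀ s' < s + 1, ∀ n, ¬ Fits k N s' 1 (n + 1) 0 N) := by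
  classical
  have h1 := hS.le_mul
  have h2 := hS.le_word
  have h3 := hS.add_le
  have h4 := hS.mul_le (show N ≤ V by omega) (show N ≤ V by omega)
  have hk := hS.two_le
  have hG : ∀ n, Fits k N s 1 (n + 1) 0 N → IsAntipalindromicQuotient k N := fun n hn =>
    (isAntipalindromicQuotient_iff hk hS.pos).2 ⟨s, n, hs, hn⟩
  have hT : k * (N * (N + k ^ s) + 1) * (14 * s + 115) + (7 * s + 38) =
      7 + (7 * s + 30 + (k * (N * (N + k ^ s) + 1) * (14 * s + 115) + 1)) := by ring
  rw [hT]
  refine Term.seq ((Term.block (Q := fun m' => m' 7 = 1 ∧ Repr k N s ⟨fun i => m (32 + 2 * i),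
    Function.update (fun i => m (33 + 2 * i)) 0 (N * N), 0, 1, 0, m 3⟩ m') ?_).mono le_rfl ?_)
  · have e : ∀ i : ℕ, 33 + 2 * i = 33 ↔ i = 0 := fun i => by omega
    have e' : ∀ i : ℕ, 32 + 2 * i ≠ 33 := fun i => by omega
    simp [setupCmd, BlockSpec, Instr.effect, Function.update_apply, hm.factor]
    refine ⟨by omega, by omega, by omega, by omega, ?_⟩
    constructor <;> simp [markAddress_ne, queueAddress_ne, hm.base, hm.factor, hm.power,
      Function.update_apply, e']
  rintro m1 ⟨h17, hm1⟩
  refine Term.seq ((startTest_term hS hm1).mono le_rfl ?_)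
  rintro m2 ⟨h27, hm2⟩
  -- The negative results of earlier rounds and of the one-digit test pass unchanged through the
  -- search as H.
  refine (searchCmd_term (H := (∀ s' < s, ∀ n, ¬ Fits k N s' 1 (n + 1) 0 N) ∧
    ¬ Fits k N s 1 1 0 N) (G := IsAntipalindromicQuotient k N) hS hm2 ?_
    (h27.trans h17)).mono le_rfl ?_
  · refine SearchState.Inv.init (by omega) hS.pos hm.mark (by simp) ?_ ?_ ?_ hG
    · simp only; split_ifs
      · exact le_rfl
      · exact hm.ans_le
    · simp only; split_ifs with h
      · exact fun _ => hG 0 h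
      · exact hm.of_ans
    · simp only; split_ifs with h
      · simp
      · exact fun h0 => ⟨hm.of_ans_zero h0, h⟩
  · rintro m3 ⟨σ, hm3, hσ, he⟩
    refine ⟨hm3.base, hm3.factor, hm3.power, fun i => by rw [hm3.mark]; exact hσ.mark_le i,
      by rw [hm3.ans]; exact hσ.ans_le, by rw [hm3.ans]; exact hσ.of_ans, ?_⟩
    rw [hm3.ans]
    intro h0 s' hs' n
    obtain ⟨ha, hb⟩ := hσ.of_ans_zero h0
    rcases Nat.lt_succ_iff_lt_or_eq.1 hs' with h | rfl
    · exact ha s' h n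
    · exact hσ.not_fits hS.pos he h0 hb n

/-! ### The loop over length differences and the total time -/

/-- The program that decides whether `N` is a quotient of antipalindromic numbers. -/
def quotientCmd : Cmd :=
  .seq (.block [.const 2 1, .mul 7 0 1, .sub 7 7 2])
    (.seq (.loop 7 (.seq roundCmd (.block [.mul 2 2 0, .mul 7 0 1, .sub 7 7 2])))
      (.block [.copy 0 3]))

/-- With Z = k + N, k ^ s < k * N ≤ Z ^ 2 gives k ^ (s + 1) ≤ Z ^ 3 and N * (N + k ^ s) + 1 ≤ 2 * Z
^ 3; the word bound is quadratic in these. -/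
theorem small_of_lt {k N s : ℕ} (hk : 2 ≤ k) (hN : 0 < N) (hs : k ^ s < k * N) :
    Small k N s (2 * (k + N) ^ 3) (4000 * (k + N) ^ 6) := by
  obtain ⟨Z, hZ⟩ : ∃ Z, Z = k + N := ⟨_, rfl⟩
  rw [← hZ]
  have hkN : k * N ≤ Z * Z := Nat.mul_le_mul (by omega) (by omega)
  have h2 : 2 * (Z * Z) ≤ Z * (Z * Z) := Nat.mul_le_mul_right _ (by omega)
  have h1 : 2 * Z ≤ Z * Z := Nat.mul_le_mul_right _ (by omega)
  have h3 : Z ^ 3 = Z * (Z * Z) := by ring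
  have hpow : k ^ (s + 1) ≤ Z * (Z * Z) := by
    rw [pow_succ']; exact Nat.mul_le_mul (by omega) (by omega)
  refine ⟨hk, hN, by omega, by omega, ?_, ?_⟩
  · have h4 : N * (N + k ^ s) ≤ Z * N + Z * (k * N) := by
      rw [← mul_add]; exact Nat.mul_le_mul (by omega) (by omega)
    have h6 : Z * (k * N) ≤ Z * (Z * Z) := Nat.mul_le_mul_left _ hkN
    have h7 : Z * N + 1 ≤ Z * Z := by nlinarith
    omega
  · have h5 : 2 ^ 6 ≤ Z ^ 6 := Nat.pow_le_pow_left (by omega) 6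
    have h6 : 2 * Z ^ 3 * (2 * Z ^ 3) = 4 * Z ^ 6 := by ring
    rw [h6]; omega

theorem lt_log_add_two {k N s : ℕ} (hk : 2 ≤ k) (hs : k ^ s < k * N) : s < Nat.log 2 N + 2 := by
  rcases s with _ | s
  · omega
  · have h1 : k ^ s < N := by
      rw [pow_succ'] at hs; exact Nat.lt_of_mul_lt_mul_left hs
    have h2 : 2 ^ s ≤ N := (Nat.pow_le_pow_left hk s).trans h1.le
    have := Nat.le_log_of_pow_le one_lt_two h2
    omega

theorem log_add_two_sq_le {N : ℕ} (hN : 0 < N) : (Nat.log 2 N + 2) ^ 2 ≤ 8 * N := by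
  -- The summand 2 strengthens the induction hypothesis, which would otherwise be too weak at l = 0.
  have h : ∀ l, (l + 2) ^ 2 + 2 ≤ 8 * 2 ^ l := by
    intro l
    induction l with
    | zero => norm_num
    | succ l ih => rw [pow_succ 2 l]; nlinarith
  have := Nat.pow_log_le_self 2 hN.ne'
  have := h (Nat.log 2 N)
  omega

/-- A bound for the time of one search. -/
def roundTime (k N : ℕ) : ℕ := 439 * (k ^ 2 * N ^ 2) * (Nat.log 2 N + 2)

theorem round_le_roundTime {k N s : ℕ} (hk : 2 ≤ k) (hN : 0 < N) (hs : k ^ s < k * N) :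
    k * (N * (N + k ^ s) + 1) * (14 * s + 115) + (7 * s + 38) + 3 + 2 ≤ roundTime k N := by
  have hS := lt_log_add_two hk hs
  rw [roundTime]
  generalize Nat.log 2 N + 2 = S at *
  have h1 : N * (N + k ^ s) + 1 ≤ 3 * (k * N ^ 2) := by
    have h2 : N * (N + k ^ s) ≤ N * (N + k * N) := Nat.mul_le_mul_left _ (by omega)
    have h3 : N * (N + k * N) = N ^ 2 + k * N ^ 2 := by ring
    have h4 : 0 < N ^ 2 := by positivity
    have h5 : 2 * N ^ 2 ≤ k * N ^ 2 := Nat.mul_le_mul_right _ hk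
    omega
  have h2 : k * (N * (N + k ^ s) + 1) * (14 * s + 115) ≤ k * (3 * (k * N ^ 2)) * (129 * S) :=
    Nat.mul_le_mul (Nat.mul_le_mul_left _ h1) (by omega)
  -- 387 = 3 * 129; the remaining 52 of 439 absorb 7 * s + 43.
  have h3 : k * (3 * (k * N ^ 2)) * (129 * S) = 387 * (k ^ 2 * N ^ 2 * S) := by ring
  have h4 : S ≤ k ^ 2 * N ^ 2 * S := Nat.le_mul_of_pos_left _ (by positivity)
  have h5 : 439 * (k ^ 2 * N ^ 2) * S = 439 * (k ^ 2 * N ^ 2 * S) := by ring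
  omega

theorem rounds_le {k N : ℕ} (hN : 0 < N) :
    (Nat.log 2 N + 2) * roundTime k N ≤ 3512 * (k ^ 2 * N ^ 3) := by
  have h := Nat.mul_le_mul_left (439 * (k ^ 2 * N ^ 2)) (log_add_two_sq_le hN)
  rw [roundTime]
  calc _ = 439 * (k ^ 2 * N ^ 2) * (Nat.log 2 N + 2) ^ 2 := by ring
    _ ≤ _ := h
    _ = _ := by ring

theorem quotientCmd_term {k N : ℕ} (hk : 2 ≤ k) :
    Term (4000 * (k + N) ^ 6) quotientCmd (start k N).mem (4000 * (k ^ 2 * N ^ 3 + 1)) fun m =>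
      (IsAntipalindromicQuotient k N → m 0 = 1) ∧
      (¬ IsAntipalindromicQuotient k N → m 0 = 0) := by
  have hW : k * N + (k + N) ≤ 4000 * (k + N) ^ 6 := by
    have h1 : (k + N) ^ 2 ≤ (k + N) ^ 6 := Nat.pow_le_pow_right (by omega) (by omega)
    nlinarith
  have hT : 3 + ((Nat.log 2 N + 2) * roundTime k N + 1 + 1) ≤ 4000 * (k ^ 2 * N ^ 3 + 1) := by
    rcases Nat.eq_zero_or_pos N with rfl | hN
    · simp [roundTime]
    · have := rounds_le (k := k) hN
      omega
  refine Term.mono (Term.seq ((Term.block (Q := fun m => Between k N 0 m ∧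
    m 7 = k * N - k ^ 0) ?_).mono le_rfl ?_)) hT fun _ h => h
  · simp [BlockSpec, Instr.effect, start]
    refine ⟨by omega, by omega, by omega, ?_⟩
    constructor <;> simp [markAddress_ne]
  rintro m ⟨hm, h7⟩
  refine Term.seq ((Term.loop (Q := fun m => m 3 ≤ 1 ∧ (m 3 = 1 ↔ IsAntipalindromicQuotient k N))
    (fun m => ∃ s, Between k N s m ∧ m 7 = k * N - k ^ s)
    -- The potential charges `roundTime` for each value of s still possible. For N = 0 the loop is
    -- never entered and the answer stays 0.
    (fun m => (Nat.log 2 N + 2 - Nat.log k (m 2)) * roundTime k N) ?_ ?_ ⟨0, hm, h7⟩).mono ?_ ?_)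
  · rintro m ⟨s, hm, h7⟩ hne
    have hs : k ^ s < k * N := by omega
    have hN : 0 < N := by
      rcases Nat.eq_zero_or_pos N with rfl | hN
      · simp at hs
      · exact hN
    have hS := small_of_lt hk hN hs
    have hlog := lt_log_add_two hk hs
    have hround := round_le_roundTime hk hN hs
    have hφ : Nat.log k (m 2) = s := by rw [hm.power, Nat.log_pow (by omega)]
    obtain ⟨d, hd⟩ := Nat.exists_eq_add_of_lt hlog
    have hd1 : Nat.log 2 N + 2 - s = d + 1 := by omega
    have hd2 : Nat.log 2 N + 2 - (s + 1) = d := by omega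
    refine ⟨k * (N * (N + k ^ s) + 1) * (14 * s + 115) + (7 * s + 38) + 3, ?_, ?_⟩
    · simp only [hφ, hd1, add_mul, one_mul]; omega
    · refine Term.seq ((roundCmd_term hS hs hm).mono le_rfl ?_)
      rintro m1 ⟨h0, h1, h2, hmark, hle, hans, hans0⟩
      have hpow : k ^ s * k = k ^ (s + 1) := (pow_succ _ _).symm
      have hlt : k ^ s < k ^ (s + 1) := Nat.pow_lt_pow_right (by omega) (by omega)
      have hv := hS.pow_le
      have hv' := hS.le_word
      have hv2 := hS.le_mul
      refine (Term.block (Q := fun m' => Between k N (s + 1) m' ∧ m' 7 = k * N - k ^ (s + 1))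
        ?_).mono le_rfl ?_
      · simp [BlockSpec, Instr.effect, h0, h1, h2, hpow]
        refine ⟨by omega, by omega, by omega, ?_⟩
        constructor <;> simp [markAddress_ne, h0, h1, hle]
        -- Marks written in this round are k ^ s < k ^ (s + 1), so the table never needs clearing.
        · exact fun i => (hmark i).trans_lt hlt
        · exact hans
        · exact fun h s' hs' => hans0 h s' (by omega)
      · rintro m2 ⟨hm2, h7'⟩
        refine ⟨⟨s + 1, hm2, h7'⟩, ?_⟩
        have hφ' : Nat.log k (m2 2) = s + 1 := by rw [hm2.power, Nat.log_pow (by omega)]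
        simp only [hφ, hφ', hd1, hd2, add_mul, one_mul]; omega
  · rintro m ⟨s, hm, h7⟩ hz
    refine ⟨hm.ans_le, hm.of_ans, fun hq => ?_⟩
    have hN : 0 < N := by
      rcases Nat.eq_zero_or_pos N with rfl | hN
      · exact absurd hq (isAntipalindromicQuotient_zero k)
      · exact hN
    obtain ⟨s', n, hs', hf⟩ := (isAntipalindromicQuotient_iff hk hN).1 hq
    -- The loop ended with k * N ≤ k ^ s, so every admissible length difference has been searched.
    have hlt : s' < s := (Nat.pow_lt_pow_iff_right (show 1 < k by omega)).1 (by omega)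
    by_contra h
    have hle := hm.ans_le
    exact hm.of_ans_zero (by omega) s' hlt n hf
  · exact Nat.add_le_add_right (Nat.mul_le_mul_right _ (Nat.sub_le _ _)) 1
  · rintro m1 ⟨hle, hq⟩
    refine (Term.block ?_).mono le_rfl fun _ h => h
    simp [BlockSpec, Instr.effect]
    refine ⟨by omega, hq.2, fun h => ?_⟩
    have : m1 3 ≠ 1 := mt hq.1 h
    omega

end RAM

theorem theorem14 :
    ∃ (P : RAM.Program) (C D : ℕ), ∀ k N : ℕ, 2 ≤ k →
      RAM.DecidesWithin P k N (IsAntipalindromicQuotient k N) (C * (k ^ 2 * N ^ 3 + 1)) ∧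
      RAM.WordsBoundedBy P k N (C * (k + N) ^ D) := by
  refine ⟨RAM.quotientCmd.compile 0, 4000, 6, fun k N hk => ?_⟩
  have h : k + N ≤ (k + N) ^ 6 := Nat.le_self_pow (by omega) _
  exact (RAM.quotientCmd_term hk).decidesWithin (by omega) (by omega)
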